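/- **Theorem 1.** Words are over the alphabet $\{A,B,C\}$, $\emptyset$ is the empty word, and a map from letters to words (a *substitution*) is extended to words as a homomorphism. For irrational $t=[a_1,a_2,a_3,\dots]\in(0,1)$ (continued fraction with partial quotients $a_i=a_i(t)$) put $k=\lfloor a_1/2\rfloor$, $\delta(t)=1-2kt$, and $\gamma(t)=1/t \bmod 1$. Let $$g(t)=\begin{cases}1-t & a_1=1\\ \gamma^2(t) & a_1 \text{ even}\\ \frac1{1+\gamma(t)} & a_1\neq 1\text{ odd.}\end{cases}$$ Define the substitution $\sigma(t)$ by: - $a_1=1$: the identity; - $a_1=2k$, $a_3\ne1$: $A\mapsto (A^{k+1}B^{k-1}C)(A^kB^{k-1}C)^{a_2-1}$, $B\mapsto (A^kB^kC)(A^kB^{k-1}C)^{a_2-1}$, $C\mapsto (A^kB^kC)(A^kB^{k-1}C)^{a_2}$; - $a_1=2k$, $a_3=1$: $A\mapsto (A^kB^kC)(A^kB^{k-1}C)^{a_2}$, $B\mapsto (A^{k+1}B^{k-1}C)(A^kB^{k-1}C)^{a_2}$, $C\mapsto (A^{k+1}B^{k-1}C)(A^kB^{k-1}C)^{a_2-1}$;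 - $a_1=2k+1\neq1$: $A\mapsto A^kB^kC$, $B\mapsto A^{k+1}B^{k-1}C$, $C\mapsto A$. Partition the circle $[0,1)$ into $A=[0,\frac12)$, $B=[\frac12,1-t)$, $C=[1-t,1)$ if $t<\frac12$, and into $C=[0,1-t)$, $B=[1-t,\frac12)$, $A=[\frac12,1)$ if $t>\frac12$. An infinite word $W$ encodes the orbit of $x$ under rotation by $t$ if its $i$-th letter ($i\ge0$) names the interval that contains $x+it \bmod 1$. A *change of endpoints* replaces $A,B,C$ by a partition of the circle whose members lie between the corresponding open and closed intervals (with $0$ and $1$ identified). In the *split circle* each point has two copies $x^+$ ($0\le x<1$) and $x^-$ ($0<x\le1$); the copies of the circle point $0$ are $0^+$ and $1^-$. Rotations preserve the sign. The interval $[a^+,b^-]$ consists of the $x^+$ with $a\le x<b$ and the $x^-$ with $a<x\le b$, and the split circle is partitioned by replacing each $[a,b)$ above by $[a^+,b^-]$. Let $\varphi_t(x^\pm)=(1-x)^\mp$ if $a_1=1$, and $\varphi_t(x^\pm)=(x/\delta(t))^\pm$ otherwise. Let $\theta$ be irrational, $\theta_0=\theta\bmod 1$, $\theta_{n+1}=g(\theta_n)$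 and $\sigma_n=\sigma(\theta_n)$. Starting from a copy $x_0$ of $x\in[0,1)$, choose successively integers $\tau_n\ge0$ such that the point $y_n$ obtained from $x_n$ by $\tau_n$ rotations by $\theta_n$ lies in $[0^+,\delta(\theta_n)^-]$, and put $x_{n+1}=\varphi_{\theta_n}(y_n)$. Let $\omega_n$ be the word of length $\tau_n$ that encodes the points $x_n,x_n+\theta_n,\dots,x_n+(\tau_n-1)\theta_n$ for the partition of the split circle belonging to $\theta_n$. Convergence of finite words to an infinite word is convergence of each letter. Then: 1. Infinitely many $\sigma_n$ are not the identity. 2. For every $x\in[0,1)$ and either copy $x_0$ of it, choices of $(\tau_n)$ exist for which infinitely many $\omega_n$ are nonempty. For every choice of $(\tau_n)$ there is an infinite word $W=\omega_0\sigma_0(\omega_1\sigma_1(\omega_2\sigma_2(\dots)))$, in the sense that $\omega_0\sigma_0(\omega_1\sigma_1(\cdots\omega_{n-1}\sigma_{n-1}(u_n)))\to W$ for all sequences of nonempty words $u_n$; if infinitely many $\omega_n$ are nonempty, then the words with $u_n=\emptyset$ also converge to $W$, and each is a left factor of the next. The word $W$ encodes the orbit of $x$ under rotation by $\theta_0$ with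 at most two errors, and exactly after a change of endpoints of $A,B,C$. 3. There is exactly one point $x(\theta)\in[0,1)$ that has a copy for which all $\tau_n=0$ (hence all $\omega_n=\emptyset$) is a possible choice. There is an infinite word $W$ such that $(\sigma_0\circ\cdots\circ\sigma_{n-1})(\omega)\to W$ for every nonempty word $\omega$, and $W$ encodes the orbit of $x(\theta)$ with at most two errors, and exactly after a change of endpoints. 4. Let $\Psi$ replace the first letter of a word by $C$, let $\sigma'_n=\sigma_n$ if $\theta_n<\frac12$ and $\sigma'_n=\Psi$ if $\theta_n>\frac12$, and let $\omega'_n=A^{k+1}B^{k-1}C$ if $a_1(\theta_n)=2k$, $\omega'_n=A^{k+1}B^k$ if $a_1(\theta_n)=2k+1\ne1$, and $\omega'_n=\Psi(\omega'_{n+1})$ if $a_1(\theta_n)=1$. Then each word $(\sigma'_0\circ\cdots\circ\sigma'_{n-1})(\omega'_n)$ is a left factor of the next, and they converge to an infinite word that encodes the orbit of $0$ under rotation by $\theta_0$. -/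

import Mathlib

namespace HalfDiscrepancy

/-! ### Words and substitutions -/

/-- The alphabet `{A, B, C}`. -/
inductive Letter where
  | A
  | B
  | C
  deriving DecidableEq

/-- Finite words; concatenation is `++` and the empty word is `[]`. -/
abbrev Word := List Letter

/-- Extension of a map from letters to words to a homomorphism of words. -/
def extend (s : Letter → Word) (w : Word) : Word := w.flatMap s

/-- The word `w ^ n`. -/
def wpow (w : Word) (n : ℕ) : Word := (List.replicate n w).flatten

/-- The finite words `w n` converge, in the cylinder topology, to the infinite word `W`:
each letter of `W` is eventually the corresponding letter of `w n`. -/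
def ConvergesTo (w : ℕ → Word) (W : ℕ → Letter) : Prop :=
  ∀ i, ∀ᶠ n in Filter.atTop, (w n)[i]? = some (W i)

/-- `W` is the limit of an increasing chain of words: each `w n` is a left factor of `w (n + 1)`,
and `W` is the only infinite word with all the `w n` as left factors. -/
def IsChainLimit (w : ℕ → Word) (W : ℕ → Letter) : Prop :=
  (∀ n, w n <+: w (n + 1)) ∧ ConvergesTo w W

/-! ### Continued fractions and the renormalization map -/

/-- The Gauss map. -/
noncomputable def gauss (t : ℝ) : ℝ := Int.fract (1 / t)

/-- The partial quotient `a_i(t)`, for `i ≥ 1` and irrational `t ∈ (0,1)`,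
where `t = [a_1, a_2, a_3, …]`. -/
noncomputable def pq (t : ℝ) (i : ℕ) : ℕ := ⌊1 / (gauss^[i - 1] t)⌋₊

/-- The map `g`: it sends `[a_1, a_2, a_3, …]` to `1 - t = [a_2 + 1, a_3, …]` if `a_1 = 1`, to
`[a_3, a_4, …]` if `a_1` is even, and to `[1, a_2, a_3, …]` if `a_1 ≠ 1` is odd. -/
noncomputable def g (t : ℝ) : ℝ :=
  if pq t 1 = 1 then 1 - t
  else if Even (pq t 1) then gauss (gauss t)
  else 1 / (1 + gauss t)

/-- `θ_n = g^n(t)`. -/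
noncomputable def thetaSeq (t : ℝ) (n : ℕ) : ℝ := g^[n] t

/-- The word `A^i B^j C`. -/
def blk (i j : ℕ) : Word :=
  List.replicate i Letter.A ++ List.replicate j Letter.B ++ [Letter.C]

/-- The substitution `σ(t)`, where `k = ⌊a_1 / 2⌋`. -/
noncomputable def subst (t : ℝ) : Letter → Word :=
  let k := pq t 1 / 2
  let a₂ := pq t 2
  if pq t 1 = 1 then fun c => [c]
  else if Even (pq t 1) then
    if pq t 3 = 1 then
      fun
      | Letter.A => blk k k ++ wpow (blk k (k - 1)) a₂
      | Letter.B => blk (k + 1) (k - 1) ++ wpow (blk k (k - 1)) a₂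
      | Letter.C => blk (k + 1) (k - 1) ++ wpow (blk k (k - 1)) (a₂ - 1)
    else
      fun
      | Letter.A => blk (k + 1) (k - 1) ++ wpow (blk k (k - 1)) (a₂ - 1)
      | Letter.B => blk k k ++ wpow (blk k (k - 1)) (a₂ - 1)
      | Letter.C => blk k k ++ wpow (blk k (k - 1)) a₂
  else
    fun
    | Letter.A => blk k k
    | Letter.B => blk (k + 1) (k - 1)
    | Letter.C => [Letter.A]

/-- `f_0 ∘ f_1 ∘ ⋯ ∘ f_{n-1}`. -/
def compSeq (f : ℕ → Word → Word) : ℕ → Word → Word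
  | 0, w => w
  | n + 1, w => compSeq f n (f n w)

/-- The truncated nested word `ω_0 σ_0(ω_1 σ_1(⋯ ω_{n-1} σ_{n-1}(u)))`. -/
def nested (om : ℕ → Word) (s : ℕ → Letter → Word) (n : ℕ) (u : Word) : Word :=
  compSeq (fun m w => om m ++ extend (s m) w) n u

/-- `σ_0 ∘ ⋯ ∘ σ_{n-1}` on words. -/
noncomputable def sigmaComp (t : ℝ) (n : ℕ) (w : Word) : Word :=
  compSeq (fun m => extend (subst (thetaSeq t m))) n w

/-! ### The maps and words used for the orbit of zero -/

/-- `Ψ` replaces the first letter by `C`. -/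
def Psi : Word → Word
  | [] => []
  | _ :: w => Letter.C :: w

/-- `σ'(t)`, which is `σ(t)` if `t < 1/2` and `Ψ` if `t > 1/2`. -/
noncomputable def substZero (t : ℝ) (w : Word) : Word :=
  if t < 1 / 2 then extend (subst t) w else Psi w

/-- The word `A^{k+1} B^{k-1} C` if `a_1 = 2k`, and `A^{k+1} B^k` if `a_1 = 2k+1`. -/
noncomputable def baseZero (t : ℝ) : Word :=
  let k := pq t 1 / 2
  if Even (pq t 1) then blk (k + 1) (k - 1)
  else List.replicate (k + 1) Letter.A ++ List.replicate k Letter.B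

/-- The word `ω'_n` as a function of `t = θ_n`: it is `baseZero t` if `a_1(t) ≠ 1`, and `Ψ(ω'_{n+1})`
if `a_1(t) = 1`, in which case `a_1(θ_{n+1}) ≠ 1`. -/
noncomputable def omegaZero (t : ℝ) : Word :=
  if pq t 1 = 1 then Psi (baseZero (g t)) else baseZero t

/-- `σ'_0 ∘ ⋯ ∘ σ'_{n-1}` on words. -/
noncomputable def sigmaZeroComp (t : ℝ) (n : ℕ) (w : Word) : Word :=
  compSeq (fun m => substZero (thetaSeq t m)) n w

/-! ### Partitions of the circle `[0,1)` and encodings -/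

/-- Left and right endpoints of the intervals `A`, `B`, `C`. -/
noncomputable def ends (t : ℝ) : Letter → ℝ × ℝ :=
  if t < 1 / 2 then
    fun
    | Letter.A => (0, 1 / 2)
    | Letter.B => (1 / 2, 1 - t)
    | Letter.C => (1 - t, 1)
  else
    fun
    | Letter.C => (0, 1 - t)
    | Letter.B => (1 - t, 1 / 2)
    | Letter.A => (1 / 2, 1)

/-- The standard half-open partition. -/
noncomputable def arc (t : ℝ) (c : Letter) : Set ℝ := Set.Ico (ends t c).1 (ends t c).2

/-- The closed arc of the circle `[0,1)`, where the point `0` is also the right endpoint `1`. -/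
noncomputable def closedArc (t : ℝ) (c : Letter) : Set ℝ :=
  {y | y ∈ Set.Ico (0 : ℝ) 1 ∧
    (y ∈ Set.Icc (ends t c).1 (ends t c).2 ∨ (y = 0 ∧ (ends t c).2 = 1))}

/-- `P` is a partition of the circle `[0,1)` that arises from `A`, `B`, `C` by a change of
endpoints. -/
def IsEndpointChange (t : ℝ) (P : Letter → Set ℝ) : Prop :=
  (∀ c, Set.Ioo (ends t c).1 (ends t c).2 ⊆ P c ∧ P c ⊆ closedArc t c) ∧
  ∀ y ∈ Set.Ico (0 : ℝ) 1, ∃! c, y ∈ P c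

/-- `W` encodes the `i`-th point of the orbit of `x` under rotation by `θ` correctly. -/
def EncodesAt (P : Letter → Set ℝ) (θ x : ℝ) (W : ℕ → Letter) (i : ℕ) : Prop :=
  ∀ c, W i = c ↔ Int.fract (x + i * θ) ∈ P c

/-- `W` encodes the orbit of `x` under rotation by `θ`, for the partition `P`. -/
def Encodes (P : Letter → Set ℝ) (θ x : ℝ) (W : ℕ → Letter) : Prop :=
  ∀ i, EncodesAt P θ x W i

/-- `W` encodes the orbit of `x` under rotation by `θ` up to at most two errors, and exactly
after a change of endpoints of the intervals `A`, `B`, `C`. -/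
def EncodesUpToEndpoints (θ x : ℝ) (W : ℕ → Letter) : Prop :=
  {i | ¬ EncodesAt (arc (Int.fract θ)) θ x W i}.encard ≤ 2 ∧
  ∃ P, IsEndpointChange (Int.fract θ) P ∧ Encodes P θ x W

/-! ### The circle with split points -/

/-- Side of a split point: `x⁺` is a limit from the right and `x⁻` a limit from the left. -/
inductive Side where
  | plus
  | minus

/-- The opposite side. -/
def Side.flip : Side → Side
  | Side.plus => Side.minus
  | Side.minus => Side.plus

/-- A point `x⁺` or `x⁻`. In the circle these are `x⁺` with `0 ≤ x < 1` and `x⁻` with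
`0 < x ≤ 1`. Splitting points at which no iterated coding is discontinuous is harmless: their two
copies have the same coding. -/
structure SplitPt where
  pos : ℝ
  side : Side

/-- The interval `[a⁺, b⁻]`. -/
def splitIcc (a b : ℝ) : Set SplitPt :=
  {p | match p.side with
    | Side.plus => a ≤ p.pos ∧ p.pos < b
    | Side.minus => a < p.pos ∧ p.pos ≤ b}

/-- `p` is one of the two copies of the point `x ∈ [0,1)` of the circle; the copies of `0` are
`0⁺` and `1⁻`. -/
def IsLift (x : ℝ) (p : SplitPt) : Prop :=
  match p.side with
  | Side.plus => p.pos = x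
  | Side.minus => p.pos = if x = 0 then 1 else x

/-- The rotation by `t`, applied `j` times, with values in `[0,1)` on the right copies and in
`(0,1]` on the left copies. -/
noncomputable def rot (t : ℝ) (j : ℕ) (p : SplitPt) : SplitPt :=
  match p.side with
  | Side.plus => ⟨Int.fract (p.pos + j * t), Side.plus⟩
  | Side.minus => ⟨p.pos + j * t + 1 - ⌈p.pos + j * t⌉, Side.minus⟩

open Classical in
/-- The letter of the closed split interval to which `p` belongs. -/
noncomputable def letterOf (t : ℝ) (p : SplitPt) : Letter :=
  if p ∈ splitIcc (ends t Letter.A).1 (ends t Letter.A).2 then Letter.A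
  else if p ∈ splitIcc (ends t Letter.B).1 (ends t Letter.B).2 then Letter.B
  else Letter.C

/-- `δ = 1 - E(a_1) t`, where `E(a)` is the largest even integer `≤ a`. -/
noncomputable def delta (t : ℝ) : ℝ := 1 - (2 * (pq t 1 / 2) : ℕ) * t

/-- The interval `I' = [0⁺, δ⁻]`. -/
noncomputable def subInterval (t : ℝ) : Set SplitPt := splitIcc 0 (delta t)

/-- The map `φ` from `I'` onto the next circle: `x ↦ 1 - x` if `a_1 = 1`, and `x ↦ x / δ`
otherwise. -/
noncomputable def phi (t : ℝ) (p : SplitPt) : SplitPt :=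
  if pq t 1 = 1 then ⟨1 - p.pos, p.side.flip⟩ else ⟨p.pos / delta t, p.side⟩

/-! ### The dynamic process -/

/-- The points `x_n` of the process started at `p`, when the orbit of `x_n` under rotation by
`θ_n` is followed for `τ n` steps before passing to the next circle. -/
noncomputable def procPt (t : ℝ) (p : SplitPt) (τ : ℕ → ℕ) : ℕ → SplitPt
  | 0 => p
  | n + 1 => phi (thetaSeq t n) (rot (thetaSeq t n) (τ n) (procPt t p τ n))

/-- At each stage the point reached after `τ n` steps lies in `I'_{n+1}`. -/
def Admissible (t : ℝ) (p : SplitPt) (τ : ℕ → ℕ) : Prop :=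
  ∀ n, rot (thetaSeq t n) (τ n) (procPt t p τ n) ∈ subInterval (thetaSeq t n)

/-- The word `ω_n` that encodes the first `τ n` points of the orbit of `x_n` under rotation by
`θ_n`. -/
noncomputable def omegaWord (t : ℝ) (p : SplitPt) (τ : ℕ → ℕ) (n : ℕ) : Word :=
  (List.range (τ n)).map fun i => letterOf (thetaSeq t n) (rot (thetaSeq t n) i (procPt t p τ n))

end HalfDiscrepancy

namespace HalfDiscrepancy

/-! The proof is a renormalization. Rotation by `t` takes a point of `I' = [0⁺, δ⁻]` back to `I'`,
and `φ` conjugates this return to rotation by `g t` on the full circle. The decisive point is that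
the itinerary read before the return depends only on the letter of `φ p` in the partition for `g t`,
and it is the image of that letter under `σ(t)` (`reads_subst`). For `a₁ ≠ 1` this works because `δ
= 1 - 2kt` uses an even number of steps: the cut `1/2` pulled back by `k` steps is `1/2 - kt = δ/2`,
the midpoint of `I'`, which `φ` sends to `1/2` again. So the partition at `1/2` and `1 - t`
reproduces itself. For `a₁ = 1` the map `φ` is a reflection, which matches the two partitions letter
by letter.

Iterating, every nested word built on a true coding at level `n` is a true coding at level `0`
(`code_nested`). Convergence for arbitrary nonempty `u_n` holds because, when `a₁ ≠ 1`, all images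
of letters begin with `A`, and this happens infinitely often; hence the images of all nonempty words
share longer and longer prefixes (`exists_common_prefix`).

On the copies of one side the split partition induces a partition that differs from the half-open
one only at `0`, `1/2` and `1 - t`. By irrationality an orbit meets each of these at most once, and
if it meets `1/2` it meets neither of the others; hence at most two errors.

The point `x(θ)` lies in a nested intersection of compact images under the inverses of `φ`; it is
unique because `δ ≤ 1/2` infinitely often. For the orbit of `0`, the copy `0⁺` is fixed by `φ` when
`a₁ ≠ 1`. When `a₁ = 1`, the symmetry `y ↦ 1 - y` compares rotation by `t` with rotation by `1 - t`,
and only the first letter changes, which is the effect of `Ψ`. -/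

/-! ### Cuts of the split line -/

/-- `p` lies to the right of the cut `a`, that is `a⁺ ≤ p`. -/
def SplitPt.Ge (p : SplitPt) (a : ℝ) : Prop :=
  match p.side with
  | Side.plus => a ≤ p.pos
  | Side.minus => a < p.pos

/-- Translation of a split point. -/
def SplitPt.shift (p : SplitPt) (s : ℝ) : SplitPt := ⟨p.pos + s, p.side⟩

theorem mem_splitIcc {p : SplitPt} {a b : ℝ} : p ∈ splitIcc a b ↔ p.Ge a ∧ ¬ p.Ge b := by
  rcases p with ⟨x, _ | _⟩ <;> simp [splitIcc, SplitPt.Ge]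

/-- Monotonicity in the cut is what removes the sides from later arguments: every membership in a
split interval becomes a linear inequality between real cuts. -/
theorem SplitPt.Ge.mono {p : SplitPt} {a b : ℝ} (h : p.Ge a) (hb : b ≤ a) : p.Ge b := by
  rcases p with ⟨x, _ | _⟩ <;> simp only [SplitPt.Ge] at * <;> linarith

theorem SplitPt.not_ge_mono {p : SplitPt} {a b : ℝ} (h : ¬ p.Ge a) (hb : a ≤ b) : ¬ p.Ge b :=
  fun h' => h (h'.mono hb)

theorem SplitPt.lt_of_ge {p : SplitPt} {a b : ℝ} (h : p.Ge a) (hb : ¬ p.Ge b) : a < b := by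
  by_contra hab
  exact hb (h.mono (not_lt.mp hab))

theorem SplitPt.Ge.le {p : SplitPt} {a : ℝ} (h : p.Ge a) : a ≤ p.pos := by
  rcases p with ⟨x, _ | _⟩ <;> simp only [SplitPt.Ge] at * <;> linarith

theorem SplitPt.le_of_not_ge {p : SplitPt} {a : ℝ} (h : ¬ p.Ge a) : p.pos ≤ a := by
  rcases p with ⟨x, _ | _⟩ <;> simp only [SplitPt.Ge] at * <;> linarith

theorem SplitPt.shift_ge {p : SplitPt} {s a : ℝ} : (p.shift s).Ge a ↔ p.Ge (a - s) := by
  rcases p with ⟨x, _ | _⟩ <;> simp only [SplitPt.Ge, SplitPt.shift] <;>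
    constructor <;> intro h <;> linarith

theorem SplitPt.shift_shift (p : SplitPt) (r s : ℝ) : (p.shift r).shift s = p.shift (r + s) := by
  simp [SplitPt.shift, add_assoc]

theorem SplitPt.shift_zero (p : SplitPt) : p.shift 0 = p := by
  simp [SplitPt.shift]

/-! ### Rotations -/

theorem shift_int_unique {p : SplitPt} {r : ℝ} {m : ℤ} (hp : p ∈ splitIcc 0 1)
    (hr : p.shift r ∈ splitIcc 0 1) (h : r = m) : p.shift r = p := by
  rw [mem_splitIcc, SplitPt.shift_ge, SplitPt.shift_ge] at hr
  rw [mem_splitIcc] at hp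
  have h₁ := SplitPt.lt_of_ge hr.1 hp.2
  have h₂ := SplitPt.lt_of_ge hp.1 hr.2
  subst h
  have h₃ : (-1 : ℝ) < m := by linarith
  have h₄ : (m : ℝ) < 1 := by linarith
  have : m = 0 := by
    have h₃ : (-1 : ℤ) < m := by exact_mod_cast h₃
    have h₄ : m < (1 : ℤ) := by exact_mod_cast h₄
    omega
  subst this
  simp [SplitPt.shift_zero]

theorem rot_mem (t : ℝ) (j : ℕ) (p : SplitPt) : rot t j p ∈ splitIcc 0 1 := by
  rcases p with ⟨x, _ | _⟩
  · exact ⟨Int.fract_nonneg _, Int.fract_lt_one _⟩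
  · refine ⟨?_, ?_⟩
    · have := Int.ceil_lt_add_one (x + j * t)
      simp only [rot]; linarith
    · have := Int.le_ceil (x + j * t)
      simp only [rot]; linarith

theorem rot_eq_shift (t : ℝ) (j : ℕ) (p : SplitPt) :
    ∃ m : ℤ, rot t j p = p.shift (j * t - m) := by
  rcases p with ⟨x, _ | _⟩
  · refine ⟨⌊x + j * t⌋, ?_⟩
    simp only [rot, SplitPt.shift, Int.fract, SplitPt.mk.injEq, and_true]
    ring
  · refine ⟨⌈x + j * t⌉ - 1, ?_⟩
    simp only [rot, SplitPt.shift, SplitPt.mk.injEq, and_true]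
    push_cast
    ring

/-- The split circle is a fundamental domain for integer translations, so a translate congruent to
`j * t` that lands in it must be the rotated point. Rotations are thereafter handled as
translations, without floors or ceilings. -/
theorem rot_eq_of_mem {t : ℝ} {j : ℕ} {p : SplitPt} (m : ℤ) {s : ℝ} (hs : s = j * t - m)
    (h : p.shift s ∈ splitIcc 0 1) : rot t j p = p.shift s := by
  obtain ⟨n, hn⟩ := rot_eq_shift t j p
  have h₁ := rot_mem t j p
  have h₂ : p.shift s = (rot t j p).shift (n - m) := by
    rw [hn, SplitPt.shift_shift, hs]; congr 1; ring
  rw [h₂] at h ⊢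
  exact (shift_int_unique (m := n - m) h₁ h (by push_cast; ring)).symm

theorem rot_zero {t : ℝ} {p : SplitPt} (hp : p ∈ splitIcc 0 1) : rot t 0 p = p := by
  rw [rot_eq_of_mem (p := p) (s := 0) 0 (by simp) (by rwa [SplitPt.shift_zero]),
    SplitPt.shift_zero]

theorem rot_rot (t : ℝ) (i j : ℕ) (p : SplitPt) : rot t i (rot t j p) = rot t (j + i) p := by
  obtain ⟨m, hm⟩ := rot_eq_shift t j p
  obtain ⟨n, hn⟩ := rot_eq_shift t i (rot t j p)
  have h := rot_mem t i (rot t j p)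
  rw [hn, hm, SplitPt.shift_shift] at h
  rw [hn, hm, SplitPt.shift_shift]
  refine (rot_eq_of_mem (m + n) ?_ h).symm
  push_cast
  ring

/-! ### Letters -/

theorem ends_of_lt {t : ℝ} (ht : t < 1 / 2) :
    ends t Letter.A = (0, 1 / 2) ∧ ends t Letter.B = (1 / 2, 1 - t) ∧
      ends t Letter.C = (1 - t, 1) := by
  simp only [ends, if_pos ht, and_self]

theorem ends_of_gt {t : ℝ} (ht : 1 / 2 < t) :
    ends t Letter.C = (0, 1 - t) ∧ ends t Letter.B = (1 - t, 1 / 2) ∧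
      ends t Letter.A = (1 / 2, 1) := by
  simp only [ends, if_neg ht.not_gt, and_self]

theorem letterOf_eq_A {t : ℝ} {p : SplitPt} (h₀ : p.Ge (ends t Letter.A).1)
    (h : ¬ p.Ge (ends t Letter.A).2) : letterOf t p = Letter.A := by
  unfold letterOf
  rw [if_pos (mem_splitIcc.2 ⟨h₀, h⟩)]

theorem letterOf_eq_B {t : ℝ} {p : SplitPt}
    (hA : ¬ (p.Ge (ends t Letter.A).1 ∧ ¬ p.Ge (ends t Letter.A).2))
    (h₀ : p.Ge (ends t Letter.B).1) (h : ¬ p.Ge (ends t Letter.B).2) :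
    letterOf t p = Letter.B := by
  unfold letterOf
  rw [if_neg (fun h' => hA (mem_splitIcc.1 h')), if_pos (mem_splitIcc.2 ⟨h₀, h⟩)]

theorem letterOf_eq_C {t : ℝ} {p : SplitPt}
    (hA : ¬ (p.Ge (ends t Letter.A).1 ∧ ¬ p.Ge (ends t Letter.A).2))
    (hB : ¬ (p.Ge (ends t Letter.B).1 ∧ ¬ p.Ge (ends t Letter.B).2)) :
    letterOf t p = Letter.C := by
  unfold letterOf
  rw [if_neg (fun h' => hA (mem_splitIcc.1 h')), if_neg (fun h' => hB (mem_splitIcc.1 h'))]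

theorem letterOf_A {t : ℝ} {p : SplitPt} (ht : t < 1 / 2) (h₀ : p.Ge 0) (h : ¬ p.Ge (1 / 2)) :
    letterOf t p = Letter.A := by
  obtain ⟨eA, -, -⟩ := ends_of_lt ht
  apply letterOf_eq_A <;> rw [eA] <;> assumption

theorem letterOf_B {t : ℝ} {p : SplitPt} (ht : t < 1 / 2) (h₀ : p.Ge (1 / 2))
    (h : ¬ p.Ge (1 - t)) : letterOf t p = Letter.B := by
  obtain ⟨eA, eB, -⟩ := ends_of_lt ht
  apply letterOf_eq_B
  · rw [eA]; exact fun h' => h'.2 h₀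
  all_goals rw [eB]; assumption

theorem letterOf_C {t : ℝ} {p : SplitPt} (ht : t < 1 / 2) (h : p.Ge (1 - t)) :
    letterOf t p = Letter.C := by
  obtain ⟨eA, eB, -⟩ := ends_of_lt ht
  apply letterOf_eq_C
  · rw [eA]; exact fun h' => h'.2 (h.mono (by linarith))
  · rw [eB]; exact fun h' => h'.2 h

theorem letterOf_A' {t : ℝ} {p : SplitPt} (ht : 1 / 2 < t) (h₀ : p.Ge (1 / 2))
    (h : ¬ p.Ge 1) : letterOf t p = Letter.A := by
  obtain ⟨-, -, eA⟩ := ends_of_gt ht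
  apply letterOf_eq_A <;> rw [eA] <;> assumption

theorem letterOf_B' {t : ℝ} {p : SplitPt} (ht : 1 / 2 < t) (h₀ : p.Ge (1 - t))
    (h : ¬ p.Ge (1 / 2)) : letterOf t p = Letter.B := by
  obtain ⟨-, eB, eA⟩ := ends_of_gt ht
  apply letterOf_eq_B
  · rw [eA]; exact fun h' => h h'.1
  all_goals rw [eB]; assumption

theorem letterOf_C' {t : ℝ} {p : SplitPt} (ht : 1 / 2 < t) (h : ¬ p.Ge (1 - t)) :
    letterOf t p = Letter.C := by
  obtain ⟨-, eB, eA⟩ := ends_of_gt ht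
  apply letterOf_eq_C
  · rw [eA]; exact fun h' => h (h'.1.mono (by linarith))
  · rw [eB]; exact fun h' => h h'.1

/-! ### Finite codings -/

/-- The coding of the first `n` points of the orbit of `p`. -/
noncomputable def code (t : ℝ) (p : SplitPt) (n : ℕ) : Word :=
  (List.range n).map fun i => letterOf t (rot t i p)

theorem length_code (t : ℝ) (p : SplitPt) (n : ℕ) : (code t p n).length = n := by
  simp [code]

theorem code_add (t : ℝ) (p : SplitPt) (m n : ℕ) :
    code t p (m + n) = code t p m ++ code t (rot t m p) n := by
  simp only [code, List.range_add, List.map_append, List.map_map, rot_rot]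
  rfl

/-- The orbit of `p` starts with the word `w` and then reaches `q`. -/
def Reads (t : ℝ) (p : SplitPt) (w : Word) (q : SplitPt) : Prop :=
  code t p w.length = w ∧ rot t w.length p = q

theorem Reads.nil {t : ℝ} {p : SplitPt} (hp : p ∈ splitIcc 0 1) : Reads t p [] p :=
  ⟨rfl, rot_zero hp⟩

theorem Reads.append {t : ℝ} {p q r : SplitPt} {v w : Word} (h : Reads t p v q)
    (h' : Reads t q w r) : Reads t p (v ++ w) r := by
  obtain ⟨h₁, rfl⟩ := h
  obtain ⟨h₃, rfl⟩ := h'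
  refine ⟨?_, ?_⟩
  · rw [List.length_append, code_add, h₁, h₃]
  · rw [List.length_append, rot_rot]

theorem Reads.mem {t : ℝ} {p q : SplitPt} {w : Word} (h : Reads t p w q) : q ∈ splitIcc 0 1 :=
  h.2 ▸ rot_mem _ _ _

theorem reads_code (t : ℝ) (p : SplitPt) (n : ℕ) : Reads t p (code t p n) (rot t n p) := by
  refine ⟨?_, ?_⟩ <;> rw [length_code]

theorem reads_singleton {t : ℝ} {p : SplitPt} (hp : p ∈ splitIcc 0 1) {c : Letter}
    (h : letterOf t p = c) {s : ℝ} (m : ℤ) (hs : s = t - m) (h' : p.shift s ∈ splitIcc 0 1) :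
    Reads t p [c] (p.shift s) := by
  refine ⟨?_, ?_⟩
  · simp [code, rot_zero hp, h]
  · exact rot_eq_of_mem (j := 1) m (by simpa using hs) h'

theorem Reads.of_append {t : ℝ} {p : SplitPt} {v w : Word}
    (h : code t p (v ++ w).length = v ++ w) :
    code t p v.length = v ∧ code t (rot t v.length p) w.length = w := by
  rw [List.length_append, code_add] at h
  exact List.append_inj h (length_code _ _ _)

theorem reads_replicate {t : ℝ} (ht : 0 < t) {p : SplitPt} (c : Letter) (m : ℕ) (h₀ : p.Ge 0)
    (h₁ : ¬ p.Ge (1 - m * t)) (hc : ∀ i < m, letterOf t (p.shift (i * t)) = c) :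
    Reads t p (List.replicate m c) (p.shift (m * t)) := by
  induction m with
  | zero =>
    simp only [Nat.cast_zero, zero_mul, sub_zero, List.replicate_zero] at *
    rw [SplitPt.shift_zero]
    exact Reads.nil (mem_splitIcc.2 ⟨h₀, h₁⟩)
  | succ m ih =>
    push_cast at h₁
    have hm : 0 ≤ (m : ℝ) * t := by positivity
    have h := ih (SplitPt.not_ge_mono h₁ (by linarith)) (fun i hi => hc i (by omega))
    rw [List.replicate_succ']
    have e : p.shift ((m + 1 : ℕ) * t) = (p.shift (m * t)).shift t := by
      rw [SplitPt.shift_shift]; congr 1; push_cast; ring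
    rw [e]
    refine h.append (reads_singleton h.mem (hc m (by omega)) 0 (by simp) ?_)
    rw [mem_splitIcc, SplitPt.shift_shift, SplitPt.shift_ge, SplitPt.shift_ge]
    exact ⟨h₀.mono (by linarith), SplitPt.not_ge_mono h₁ (by linarith)⟩

/-- The block `A^i B^j C` is read along one turn around the circle. -/
theorem reads_blk {t : ℝ} (ht : 0 < t) (ht' : t < 1 / 2) {p : SplitPt} {i j : ℕ} (h₀ : p.Ge 0)
    (hA : ¬ p.Ge (1 / 2 - (i - 1) * t)) (hB : p.Ge (1 / 2 - i * t))
    (hBC : ¬ p.Ge (1 - (i + j) * t)) (hC : p.Ge (1 - (i + j + 1) * t)) :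
    Reads t p (blk i j) (p.shift ((i + j + 1) * t - 1)) := by
  have hi : 0 ≤ (i : ℝ) * t := by positivity
  have hj : 0 ≤ (j : ℝ) * t := by positivity
  have r₁ : Reads t p (List.replicate i Letter.A) (p.shift (i * t)) := by
    refine reads_replicate ht _ i h₀ (SplitPt.not_ge_mono hBC (by linarith)) fun l hl => ?_
    have hl' : ((l : ℝ) + 1) * t ≤ i * t := by
      gcongr; exact_mod_cast hl
    have : 0 ≤ (l : ℝ) * t := by positivity
    apply letterOf_A ht' <;> rw [SplitPt.shift_ge]
    · exact h₀.mono (by linarith)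
    · exact SplitPt.not_ge_mono hA (by linarith)
  have r₂ : Reads t (p.shift (i * t)) (List.replicate j Letter.B)
      ((p.shift (i * t)).shift (j * t)) := by
    refine reads_replicate ht _ j ?_ ?_ fun l hl => ?_
    · rw [SplitPt.shift_ge]; exact h₀.mono (by linarith)
    · rw [SplitPt.shift_ge]; exact SplitPt.not_ge_mono hBC (by linarith)
    · have hl' : ((l : ℝ) + 1) * t ≤ j * t := by
        gcongr; exact_mod_cast hl
      have : 0 ≤ (l : ℝ) * t := by positivity
      apply letterOf_B ht' <;> rw [SplitPt.shift_shift, SplitPt.shift_ge]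
      · exact hB.mono (by linarith)
      · exact SplitPt.not_ge_mono hBC (by linarith)
  have e : p.shift ((i + j + 1) * t - 1) = ((p.shift (i * t)).shift (j * t)).shift (t - 1) := by
    rw [SplitPt.shift_shift, SplitPt.shift_shift]; congr 1; ring
  rw [e]
  refine (r₁.append r₂).append (reads_singleton r₂.mem (letterOf_C ht' ?_) 1 (by simp) ?_)
  · rw [SplitPt.shift_shift, SplitPt.shift_ge]; exact hC.mono (by linarith)
  · rw [mem_splitIcc, SplitPt.shift_shift, SplitPt.shift_shift, SplitPt.shift_ge,
      SplitPt.shift_ge]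
    exact ⟨hC.mono (by linarith), SplitPt.not_ge_mono hBC (by linarith)⟩

/-! ### Arithmetic of the renormalization -/

/-- `t` is an irrational number in the unit interval. -/
structure UnitIrrational (t : ℝ) : Prop where
  irrational : Irrational t
  pos : 0 < t
  lt_one : t < 1

theorem unitIrrational_fract {t : ℝ} (h : Irrational t) : UnitIrrational (Int.fract t) := by
  have h' : Irrational (Int.fract t) := by
    rw [Int.fract]; exact h.sub_intCast _
  exact ⟨h', lt_of_le_of_ne (Int.fract_nonneg t) h'.ne_zero.symm, Int.fract_lt_one t⟩

namespace UnitIrrational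

variable {t : ℝ}

theorem gauss (h : UnitIrrational t) : UnitIrrational (gauss t) := by
  apply unitIrrational_fract
  rw [one_div]
  exact h.irrational.inv

theorem pq_add_gauss (h : UnitIrrational t) :
    ((pq t 1 : ℝ) + HalfDiscrepancy.gauss t) * t = 1 := by
  have h₁ : (pq t 1 : ℝ) = ⌊1 / t⌋ := by
    have : 0 ≤ 1 / t := by have := h.pos; positivity
    simp only [pq, Nat.sub_self, Function.iterate_zero, id]
    exact natCast_floor_eq_intCast_floor this
  rw [h₁, HalfDiscrepancy.gauss, Int.floor_add_fract, one_div, inv_mul_cancel₀ h.pos.ne']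

theorem one_le_pq (h : UnitIrrational t) : 1 ≤ pq t 1 := by
  by_contra h₀
  have h₀ : pq t 1 = 0 := by omega
  have := h.pq_add_gauss
  rw [h₀] at this
  have h₁ := h.gauss.lt_one
  have h₂ := h.gauss.pos
  have h₃ := h.pos
  have h₄ := h.lt_one
  simp only [Nat.cast_zero, zero_add] at this
  nlinarith

theorem half_lt (h : UnitIrrational t) (h₁ : pq t 1 = 1) : 1 / 2 < t := by
  have := h.pq_add_gauss
  rw [h₁] at this
  push_cast at this
  nlinarith [h.gauss.lt_one, h.pos]

theorem lt_half (h : UnitIrrational t) (h₁ : pq t 1 ≠ 1) : t < 1 / 2 := by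
  have := h.pq_add_gauss
  have h₂ : (2 : ℝ) ≤ pq t 1 := by
    have := h.one_le_pq
    exact_mod_cast (by omega : 2 ≤ pq t 1)
  nlinarith [h.gauss.pos, h.pos]

theorem pq_eq_one_iff (h : UnitIrrational t) : pq t 1 = 1 ↔ 1 / 2 < t :=
  ⟨h.half_lt, fun h' => by
    by_contra h₁
    exact (h.lt_half h₁).not_gt h'⟩

theorem one_sub (h : UnitIrrational t) : UnitIrrational (1 - t) :=
  ⟨by simpa using h.irrational.ratCast_sub 1, by linarith [h.lt_one], by linarith [h.pos]⟩

theorem g (h : UnitIrrational t) : UnitIrrational (g t) := by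
  unfold HalfDiscrepancy.g
  split_ifs
  · exact h.one_sub
  · exact h.gauss.gauss
  · have h₁ := h.gauss.pos
    refine ⟨?_, by positivity, ?_⟩
    · rw [one_div]
      apply Irrational.inv
      simpa using h.gauss.irrational.ratCast_add 1
    · rw [div_lt_one (by linarith)]; linarith

theorem thetaSeq (h : UnitIrrational t) (n : ℕ) : UnitIrrational (thetaSeq t n) := by
  induction n with
  | zero => exact h
  | succ n ih =>
    rw [HalfDiscrepancy.thetaSeq, Function.iterate_succ_apply']
    exact ih.g

end UnitIrrational

theorem thetaSeq_succ (t : ℝ) (n : ℕ) : thetaSeq t (n + 1) = g (thetaSeq t n) := by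
  rw [thetaSeq, Function.iterate_succ_apply', thetaSeq]

theorem g_of_eq_one {t : ℝ} (h : pq t 1 = 1) : g t = 1 - t := if_pos h

theorem g_of_even {t : ℝ} (he : Even (pq t 1)) : g t = gauss (gauss t) := by
  rw [g, if_neg (by rintro h; rw [h] at he; exact absurd he (by decide)), if_pos he]

theorem g_of_odd {t : ℝ} (h : pq t 1 ≠ 1) (ho : ¬ Even (pq t 1)) : g t = 1 / (1 + gauss t) := by
  rw [g, if_neg h, if_neg ho]

theorem delta_of_eq_one {t : ℝ} (h : pq t 1 = 1) : delta t = 1 := by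
  simp [delta, h]

theorem pq_two (t : ℝ) : pq t 2 = pq (gauss t) 1 := rfl

theorem pq_three (t : ℝ) : pq t 3 = pq (gauss (gauss t)) 1 := rfl

/-- Two steps of the Euclidean algorithm: `δ` is the remainder of `1` by `t`, and `t` divided by `δ`
has quotient `a₂` and remainder `g t * δ`. -/
theorem delta_of_even {t : ℝ} (ht : UnitIrrational t) (he : Even (pq t 1)) :
    delta t = gauss t * t ∧ t = (pq t 2 + g t) * delta t := by
  have h₁ : delta t = gauss t * t := by
    rw [delta, Nat.two_mul_div_two_of_even he]
    linarith [ht.pq_add_gauss]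
  refine ⟨h₁, ?_⟩
  rw [h₁, g_of_even he, pq_two, ← mul_assoc, ht.gauss.pq_add_gauss, one_mul]

/-- Here only `a₁ - 1` copies of `t` are removed from `1`, so one `t` is left over on top of the
Euclidean remainder and `δ` exceeds `t`. -/
theorem delta_of_odd {t : ℝ} (ht : UnitIrrational t) (h : pq t 1 ≠ 1) (ho : ¬ Even (pq t 1)) :
    delta t = (1 + gauss t) * t ∧ t = g t * delta t := by
  have h₁ : delta t = (1 + gauss t) * t := by
    have e : 2 * (pq t 1 / 2) + 1 = pq t 1 :=
      Nat.two_mul_div_two_add_one_of_odd (Nat.not_even_iff_odd.mp ho)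
    have e' : ((2 * (pq t 1 / 2) : ℕ) : ℝ) + 1 = pq t 1 := by exact_mod_cast e
    rw [delta]
    have := ht.pq_add_gauss
    rw [← e'] at this
    linarith
  refine ⟨h₁, ?_⟩
  have := ht.gauss.pos
  rw [h₁, g_of_odd h ho]
  field_simp

theorem delta_pos {t : ℝ} (ht : UnitIrrational t) : 0 < delta t := by
  have h₁ := ht.gauss.pos
  have h₂ := ht.pos
  by_cases h : pq t 1 = 1
  · rw [delta_of_eq_one h]; exact one_pos
  by_cases he : Even (pq t 1)
  · rw [(delta_of_even ht he).1]; positivity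
  · rw [(delta_of_odd ht h he).1]; positivity

/-- For odd `a₁ ≥ 3` the bound is `(1 + γ) / (a₁ + γ) ≤ (1 + γ) / (3 + γ) < 1/2`, since `γ < 1`.
This uniform expansion of `φ` gives the uniqueness of `x(θ)`. -/
theorem delta_le_half {t : ℝ} (ht : UnitIrrational t) (h : pq t 1 ≠ 1) : delta t ≤ 1 / 2 := by
  have h₁ := ht.gauss.lt_one
  have h₂ := ht.pos
  have h₃ := ht.lt_half h
  by_cases he : Even (pq t 1)
  · rw [(delta_of_even ht he).1]; nlinarith
  · rw [(delta_of_odd ht h he).1]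
    have h₄ : 3 ≤ pq t 1 := by
      have := ht.one_le_pq
      rcases Nat.not_even_iff_odd.mp he with ⟨k, hk⟩
      omega
    have h₅ : (3 : ℝ) ≤ pq t 1 := by exact_mod_cast h₄
    nlinarith [ht.pq_add_gauss, ht.gauss.pos]

theorem delta_le_one {t : ℝ} (ht : UnitIrrational t) : delta t ≤ 1 := by
  by_cases h : pq t 1 = 1
  · rw [delta_of_eq_one h]
  · linarith [delta_le_half ht h]

/-- If `t > 1/2` then `1 - t < 1/2`, so identity substitutions never occur twice in a row. -/
theorem pq_g_ne_one {t : ℝ} (ht : UnitIrrational t) (h : pq t 1 = 1) : pq (g t) 1 ≠ 1 := by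
  intro h'
  have h₁ := ht.half_lt h
  have h₂ := ht.g.half_lt h'
  rw [g_of_eq_one h] at h₂
  linarith

/-! ### The map `φ` -/

/-- Reflection reverses the order and flips the copy, so the equivalence is exact even at the cut
itself. -/
theorem phi_ge_of_eq_one {t : ℝ} (h : pq t 1 = 1) {p : SplitPt} {a : ℝ} :
    (phi t p).Ge a ↔ ¬ p.Ge (1 - a) := by
  rw [phi, if_pos h]
  rcases p with ⟨x, _ | _⟩ <;> simp only [SplitPt.Ge, Side.flip, not_lt, not_le] <;>
    constructor <;> intro h <;> linarith

theorem phi_ge {t : ℝ} (ht : UnitIrrational t) (h : pq t 1 ≠ 1) {p : SplitPt} {a : ℝ} :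
    (phi t p).Ge a ↔ p.Ge (a * delta t) := by
  have := delta_pos ht
  rw [phi, if_neg h]
  rcases p with ⟨x, _ | _⟩ <;> simp only [SplitPt.Ge]
  · rw [le_div_iff₀ this]
  · rw [lt_div_iff₀ this]

theorem phi_shift {t : ℝ} (h : pq t 1 ≠ 1) (p : SplitPt) (s : ℝ) :
    phi t (p.shift s) = (phi t p).shift (s / delta t) := by
  simp [phi, if_neg h, SplitPt.shift, add_div]

theorem phi_mem {t : ℝ} (ht : UnitIrrational t) {p : SplitPt} :
    phi t p ∈ splitIcc 0 1 ↔ p ∈ subInterval t := by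
  rw [subInterval, mem_splitIcc, mem_splitIcc]
  by_cases h : pq t 1 = 1
  · rw [phi_ge_of_eq_one h, phi_ge_of_eq_one h, delta_of_eq_one h, not_not, and_comm]
    simp
  · rw [phi_ge ht h, phi_ge ht h]
    simp

theorem subInterval_subset {t : ℝ} (ht : UnitIrrational t) : subInterval t ⊆ splitIcc 0 1 := by
  intro p hp
  rw [subInterval, mem_splitIcc] at hp
  exact mem_splitIcc.2 ⟨hp.1, SplitPt.not_ge_mono hp.2 (delta_le_one ht)⟩

theorem phi_shift_eq_rot {t : ℝ} (ht : UnitIrrational t) (h : pq t 1 ≠ 1) {p : SplitPt} {s : ℝ}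
    (m : ℤ) (hs : s = (g t - m) * delta t) (hq : p.shift s ∈ subInterval t) :
    phi t (p.shift s) = rot (g t) 1 (phi t p) := by
  have e := phi_shift h p s
  have hq' := (phi_mem ht).2 hq
  rw [e] at hq' ⊢
  refine (rot_eq_of_mem m ?_ hq').symm
  have := (delta_pos ht).ne'
  rw [hs]
  field_simp
  push_cast
  ring

/-! ### Blocks -/

/-- Beyond `δ` a turn around the circle takes only `2k` steps, and `2kt - 1 = -δ`. -/
theorem reads_blk_short {t δ : ℝ} {k : ℕ} (ht : 0 < t) (ht' : t < 1 / 2) (hk : 1 ≤ k)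
    (hδ : δ = 1 - 2 * k * t) (hδ₀ : 0 < δ) {p : SplitPt} (h : p.Ge δ) (h' : ¬ p.Ge t) :
    Reads t p (blk k (k - 1)) (p.shift (-δ)) := by
  obtain ⟨k, rfl⟩ : ∃ l, k = l + 1 := ⟨k - 1, by omega⟩
  rw [Nat.add_sub_cancel]
  push_cast at hδ
  have e : (((k + 1 : ℕ) : ℝ) + k + 1) * t - 1 = -δ := by rw [hδ]; push_cast; ring
  rw [← e]
  refine reads_blk ht ht' (h.mono hδ₀.le) (SplitPt.not_ge_mono h' ?_) (h.mono ?_)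
    (SplitPt.not_ge_mono h' ?_) (h.mono ?_) <;> push_cast <;> linarith

/-- From a point of `I'` a turn takes `2k + 1` steps. Left of `δ/2 = 1/2 - kt` the point after `k`
steps is still before `1/2`, which gives one more `A` and one less `B` than on the right half. The
cut `δ - t` makes the point after `2k` steps lie in `C`. -/
theorem reads_blk_left {t δ : ℝ} {k : ℕ} (ht : 0 < t) (ht' : t < 1 / 2) (hk : 1 ≤ k)
    (hδ : δ = 1 - 2 * k * t) (hδ₀ : 0 < δ) {p : SplitPt} (h₀ : p.Ge 0) (h : p.Ge (δ - t))
    (h' : ¬ p.Ge (δ / 2)) : Reads t p (blk (k + 1) (k - 1)) (p.shift (t - δ)) := by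
  obtain ⟨k, rfl⟩ : ∃ l, k = l + 1 := ⟨k - 1, by omega⟩
  rw [Nat.add_sub_cancel]
  push_cast at hδ
  have e : (((k + 1 + 1 : ℕ) : ℝ) + k + 1) * t - 1 = t - δ := by rw [hδ]; push_cast; ring
  rw [← e]
  have hm := SplitPt.lt_of_ge h h'
  refine reads_blk ht ht' h₀ (SplitPt.not_ge_mono h' ?_) (h.mono ?_)
    (SplitPt.not_ge_mono h' ?_) (h.mono ?_) <;> push_cast <;> linarith

theorem reads_blk_right {t δ : ℝ} {k : ℕ} (ht : 0 < t) (ht' : t < 1 / 2)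
    (hδ : δ = 1 - 2 * k * t) (hδ₀ : 0 < δ) (hδt : δ ≤ 2 * t) {p : SplitPt} (h : p.Ge (δ - t))
    (h₂ : p.Ge (δ / 2)) (h' : ¬ p.Ge δ) : Reads t p (blk k k) (p.shift (t - δ)) := by
  have e : ((k : ℝ) + k + 1) * t - 1 = t - δ := by rw [hδ]; ring
  rw [← e]
  refine reads_blk ht ht' (h₂.mono (by linarith)) (SplitPt.not_ge_mono h' ?_) (h₂.mono ?_)
    (SplitPt.not_ge_mono h' ?_) (h.mono ?_) <;> linarith

theorem reads_wpow_blk_short {t δ : ℝ} {k : ℕ} (ht : 0 < t) (ht' : t < 1 / 2) (hk : 1 ≤ k)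
    (hδ : δ = 1 - 2 * k * t) (hδ₀ : 0 < δ) (m : ℕ) {p : SplitPt} (h₀ : p.Ge 0)
    (h : p.Ge (m * δ)) (h' : ¬ p.Ge t) :
    Reads t p (wpow (blk k (k - 1)) m) (p.shift (-(m * δ))) := by
  induction m generalizing p with
  | zero =>
    simp only [wpow, List.replicate_zero, List.flatten_nil, Nat.cast_zero, zero_mul, neg_zero,
      SplitPt.shift_zero]
    exact Reads.nil (mem_splitIcc.2 ⟨h₀, SplitPt.not_ge_mono h' (by linarith)⟩)
  | succ m ih =>
    push_cast at h
    have hm : 0 ≤ (m : ℝ) * δ := by positivity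
    have r₁ := reads_blk_short ht ht' hk hδ hδ₀ (h.mono (by linarith)) h'
    have r₂ := ih (p := p.shift (-δ)) (SplitPt.shift_ge.2 (h.mono (by linarith)))
      (SplitPt.shift_ge.2 (h.mono (by linarith)))
      (fun h'' => SplitPt.not_ge_mono h' (by linarith) (SplitPt.shift_ge.1 h''))
    have e : p.shift (-((m + 1 : ℕ) * δ)) = (p.shift (-δ)).shift (-(m * δ)) := by
      rw [SplitPt.shift_shift]; congr 1; push_cast; ring
    have e' : wpow (blk k (k - 1)) (m + 1) = blk k (k - 1) ++ wpow (blk k (k - 1)) m := by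
      simp [wpow, List.replicate_succ]
    rw [e, e']
    exact r₁.append r₂

/-! ### Reading the image of a letter -/

theorem two_le_pq {t : ℝ} (ht : UnitIrrational t) (h : pq t 1 ≠ 1) : 2 ≤ pq t 1 := by
  have := ht.one_le_pq
  omega

theorem delta_eq (t : ℝ) : delta t = 1 - 2 * (pq t 1 / 2 : ℕ) * t := by
  rw [delta]; push_cast; ring

/-- The reflection carries the partition for `t > 1/2` onto the one for `1 - t < 1/2` with the same
letters, and reverses the direction of rotation. -/
theorem reads_subst_of_eq_one {t : ℝ} (ht : UnitIrrational t) (h : pq t 1 = 1) {p : SplitPt}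
    (hp : p ∈ subInterval t) :
    ∃ q ∈ subInterval t, Reads t p (subst t (letterOf (g t) (phi t p))) q ∧
      phi t q = rot (g t) 1 (phi t p) := by
  have hp' := subInterval_subset ht hp
  obtain ⟨m, hm⟩ := rot_eq_shift t 1 p
  have hq := rot_mem t 1 p
  have hq' : rot t 1 p ∈ subInterval t := by
    rwa [subInterval, delta_of_eq_one h]
  refine ⟨rot t 1 p, hq', ?_, ?_⟩
  · have hs : subst t (letterOf (g t) (phi t p)) = [letterOf t p] := by
      simp only [subst, h, if_true, List.cons.injEq, and_true]
      have h₁ := ht.half_lt h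
      rw [mem_splitIcc] at hp'
      have h₂ : 1 - t < 1 / 2 := by linarith
      rw [g_of_eq_one h]
      by_cases hA : p.Ge (1 / 2)
      · rw [letterOf_A' h₁ hA hp'.2]
        apply letterOf_A h₂
        · rw [phi_ge_of_eq_one h]; simpa using hp'.2
        · rw [phi_ge_of_eq_one h, not_not]; exact hA.mono (by norm_num)
      by_cases hB : p.Ge (1 - t)
      · rw [letterOf_B' h₁ hB hA]
        apply letterOf_B h₂
        · rw [phi_ge_of_eq_one h]; exact SplitPt.not_ge_mono hA (by norm_num)
        · rw [phi_ge_of_eq_one h, not_not]; exact hB.mono (by linarith)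
      · rw [letterOf_C' h₁ hB]
        apply letterOf_C h₂
        rw [phi_ge_of_eq_one h]; exact SplitPt.not_ge_mono hB (by linarith)
    rw [hs]
    simpa [code, rot_zero hp'] using reads_code t p 1
  · have e : phi t (rot t 1 p) = (phi t p).shift (m - t) := by
      rw [hm, phi, phi, if_pos h, if_pos h]
      simp only [SplitPt.shift, SplitPt.mk.injEq, and_true]
      push_cast; ring
    have hq'' := (phi_mem ht).2 hq'
    rw [e] at hq'' ⊢
    refine (rot_eq_of_mem (1 - m) ?_ hq'').symm
    rw [g_of_eq_one h]; push_cast; ring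

/-- Since `t < δ < 2t`, the points left of `δ - t` stay in `I'` after one step, reading `A`; all
others make one turn, and `δ/2` separates the two possible blocks. The same inequalities give `g t >
1/2`, so the cuts `δ - t` and `δ/2` become `1 - g t` and `1/2`. -/
theorem reads_subst_of_odd {t : ℝ} (ht : UnitIrrational t) (h : pq t 1 ≠ 1)
    (ho : ¬ Even (pq t 1)) {p : SplitPt} (hp : p ∈ subInterval t) :
    ∃ q ∈ subInterval t, Reads t p (subst t (letterOf (g t) (phi t p))) q ∧
      phi t q = rot (g t) 1 (phi t p) := by
  have hp' := subInterval_subset ht hp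
  rw [subInterval, mem_splitIcc] at hp
  have ht₀ := ht.pos
  have ht' := ht.lt_half h
  have hk : 1 ≤ pq t 1 / 2 := by have := two_le_pq ht h; omega
  have hδ₀ := delta_pos ht
  have hδ := delta_eq t
  obtain ⟨hd, hg⟩ := delta_of_odd ht h ho
  have hγ₀ := ht.gauss.pos
  have hγ₁ := ht.gauss.lt_one
  have hδt : delta t ≤ 2 * t := by rw [hd]; nlinarith
  have htδ : t < delta t := by rw [hd]; nlinarith
  have hg' : 1 / 2 < g t := by
    by_contra hg'
    nlinarith
  by_cases hC : p.Ge (delta t - t)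
  · have hq : p.shift (t - delta t) ∈ subInterval t := by
      rw [subInterval, mem_splitIcc, SplitPt.shift_ge, SplitPt.shift_ge]
      exact ⟨hC.mono (by linarith), SplitPt.not_ge_mono hp.2 (by linarith)⟩
    refine ⟨_, hq, ?_, phi_shift_eq_rot ht h 1 (by push_cast; linarith) hq⟩
    by_cases hA : p.Ge (delta t / 2)
    · have hl : letterOf (g t) (phi t p) = Letter.A := by
        apply letterOf_A' hg' <;> rw [phi_ge ht h]
        · exact hA.mono (by linarith)
        · simpa using hp.2
      simp only [hl, subst, if_neg h, if_neg ho]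
      exact reads_blk_right ht₀ ht' hδ hδ₀ hδt hC hA hp.2
    · have hl : letterOf (g t) (phi t p) = Letter.B := by
        apply letterOf_B' hg' <;> rw [phi_ge ht h]
        · exact hC.mono (by linarith)
        · exact SplitPt.not_ge_mono hA (by linarith)
      simp only [hl, subst, if_neg h, if_neg ho]
      exact reads_blk_left ht₀ ht' hk hδ hδ₀ hp.1 hC hA
  · have hq : p.shift t ∈ subInterval t := by
      rw [subInterval, mem_splitIcc, SplitPt.shift_ge, SplitPt.shift_ge]
      exact ⟨hp.1.mono (by linarith), hC⟩
    refine ⟨_, hq, ?_, phi_shift_eq_rot ht h 0 (by push_cast; linarith) hq⟩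
    have hl : letterOf (g t) (phi t p) = Letter.C := by
      apply letterOf_C' hg'
      rw [phi_ge ht h]
      exact SplitPt.not_ge_mono hC (by linarith)
    simp only [hl, subst, if_neg h, if_neg ho]
    refine reads_singleton hp' (letterOf_A ht' hp.1 (SplitPt.not_ge_mono hC ?_)) 0 (by simp)
      (subInterval_subset ht hq)
    linarith [delta_le_half ht h]

/-- Two independent binary choices determine the itinerary: the cut `δ/2` selects the first block,
and the cut `(1 - g t) δ` decides whether rotation by `g t` wraps around, which costs one more short
block. Of the four combinations three occur. Which three depends on the order of the two cuts, that
is on whether `g t > 1/2`, equivalently `a₃ = 1`. -/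
theorem reads_subst_of_even {t : ℝ} (ht : UnitIrrational t) (he : Even (pq t 1)) {p : SplitPt}
    (hp : p ∈ subInterval t) :
    ∃ q ∈ subInterval t, Reads t p (subst t (letterOf (g t) (phi t p))) q ∧
      phi t q = rot (g t) 1 (phi t p) := by
  have h : pq t 1 ≠ 1 := by rintro h; rw [h] at he; exact absurd he (by decide)
  have hp' := subInterval_subset ht hp
  rw [subInterval, mem_splitIcc] at hp
  have ht₀ := ht.pos
  have ht' := ht.lt_half h
  have hk : 1 ≤ pq t 1 / 2 := by have := two_le_pq ht h; omega
  have hδ₀ := delta_pos ht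
  have hδ := delta_eq t
  obtain ⟨hd, hg⟩ := delta_of_even ht he
  have hγ₀ := ht.gauss.pos
  have hγ₁ := ht.gauss.lt_one
  have htδ : delta t < t := by rw [hd]; nlinarith
  have hg₀ := ht.g.pos
  have hg₁ := ht.g.lt_one
  have ha : 1 ≤ pq t 2 := by rw [pq_two]; exact ht.gauss.one_le_pq
  have hpq3 : pq t 3 = 1 ↔ 1 / 2 < g t := by
    rw [pq_three, ← g_of_even he]; exact ht.g.pq_eq_one_iff
  have hgδ : 0 < g t * delta t := by positivity
  have hgδ' : g t * delta t < delta t := by nlinarith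
  -- the common continuation after the first block
  have key : ∀ (w : Word) (m : ℕ) (e : ℤ), Reads t p w (p.shift (t - delta t)) →
      (m : ℝ) = pq t 2 - 1 + e → p.Ge ((e - g t) * delta t) →
      ¬ p.Ge ((1 + e - g t) * delta t) →
      ∃ q ∈ subInterval t, Reads t p (w ++ wpow (blk (pq t 1 / 2) (pq t 1 / 2 - 1)) m) q ∧
        phi t q = rot (g t) 1 (phi t p) := by
    intro w m e hw hm h₁ h₂
    -- From `t = (a₂ + g t) δ`; the integer `e` is `1` if the rotation by `g t` wraps around and `0`
    -- otherwise.
    have hs : t - delta t + -(m * delta t) = (g t - e) * delta t := by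
      rw [hm]; linarith
    have hq : (p.shift (t - delta t)).shift (-(m * delta t)) ∈ subInterval t := by
      rw [SplitPt.shift_shift, subInterval, mem_splitIcc, SplitPt.shift_ge, SplitPt.shift_ge, hs]
      exact ⟨h₁.mono (by linarith), SplitPt.not_ge_mono h₂ (by linarith)⟩
    refine ⟨_, hq, hw.append (reads_wpow_blk_short ht₀ ht' hk hδ hδ₀ m ?_ ?_ ?_), ?_⟩
    · rw [SplitPt.shift_ge]; exact hp.1.mono (by linarith)
    · rw [SplitPt.shift_ge]; exact h₁.mono (by linarith)
    · rw [SplitPt.shift_ge]; exact SplitPt.not_ge_mono hp.2 (by linarith)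
    · rw [SplitPt.shift_shift] at hq ⊢
      exact phi_shift_eq_rot ht h e hs hq
  have hm₀ : ((pq t 2 - 1 : ℕ) : ℝ) = pq t 2 - 1 + (0 : ℤ) := by push_cast [ha]; ring
  have hm₁ : (pq t 2 : ℝ) = pq t 2 - 1 + (1 : ℤ) := by push_cast; ring
  have hge0 : p.Ge (((0 : ℤ) - g t) * delta t) := hp.1.mono (by push_cast; linarith)
  have hge1 : ¬ p.Ge ((1 + (1 : ℤ) - g t) * delta t) :=
    SplitPt.not_ge_mono hp.2 (by push_cast; linarith)
  have left : ¬ p.Ge (delta t / 2) → Reads t p (blk (pq t 1 / 2 + 1) (pq t 1 / 2 - 1))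
      (p.shift (t - delta t)) := fun hA =>
    reads_blk_left ht₀ ht' hk hδ hδ₀ hp.1 (hp.1.mono (by linarith)) hA
  have right : p.Ge (delta t / 2) → Reads t p (blk (pq t 1 / 2) (pq t 1 / 2))
      (p.shift (t - delta t)) := fun hA =>
    reads_blk_right ht₀ ht' hδ hδ₀ (by linarith) (hp.1.mono (by linarith)) hA hp.2
  by_cases h3 : pq t 3 = 1
  · have hg' := hpq3.1 h3
    by_cases hA : p.Ge (delta t / 2)
    · have hl : letterOf (g t) (phi t p) = Letter.A := by
        apply letterOf_A' hg' <;> rw [phi_ge ht h]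
        · exact hA.mono (by linarith)
        · simpa using hp.2
      simp only [hl, subst, if_neg h, if_pos he, if_pos h3]
      refine key _ _ 1 (right hA) hm₁ (hA.mono ?_) hge1
      push_cast; nlinarith
    by_cases hB : p.Ge ((1 - g t) * delta t)
    · have hl : letterOf (g t) (phi t p) = Letter.B := by
        apply letterOf_B' hg' <;> rw [phi_ge ht h]
        · exact hB
        · exact SplitPt.not_ge_mono hA (by linarith)
      simp only [hl, subst, if_neg h, if_pos he, if_pos h3]
      exact key _ _ 1 (left hA) hm₁ (hB.mono (by push_cast; linarith)) hge1
    · have hl : letterOf (g t) (phi t p) = Letter.C := by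
        apply letterOf_C' hg'
        rwa [phi_ge ht h]
      simp only [hl, subst, if_neg h, if_pos he, if_pos h3]
      exact key _ _ 0 (left hA) hm₀ hge0 (SplitPt.not_ge_mono hB (by push_cast; linarith))
  · have hg' : g t < 1 / 2 := by
      apply ht.g.lt_half
      rwa [g_of_even he, ← pq_three]
    by_cases hC : p.Ge ((1 - g t) * delta t)
    · have hl : letterOf (g t) (phi t p) = Letter.C := by
        apply letterOf_C hg'
        rwa [phi_ge ht h]
      simp only [hl, subst, if_neg h, if_pos he, if_neg h3]
      refine key _ _ 1 (right (hC.mono ?_)) hm₁ (hC.mono (by push_cast; linarith)) hge1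
      nlinarith
    have hC' : ¬ p.Ge ((1 + (0 : ℤ) - g t) * delta t) :=
      SplitPt.not_ge_mono hC (by push_cast; linarith)
    by_cases hA : p.Ge (delta t / 2)
    · have hl : letterOf (g t) (phi t p) = Letter.B := by
        apply letterOf_B hg' <;> rw [phi_ge ht h]
        · exact hA.mono (by linarith)
        · exact hC
      simp only [hl, subst, if_neg h, if_pos he, if_neg h3]
      exact key _ _ 0 (right hA) hm₀ hge0 hC'
    · have hl : letterOf (g t) (phi t p) = Letter.A := by
        apply letterOf_A hg' <;> rw [phi_ge ht h]
        · simpa using hp.1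
        · exact SplitPt.not_ge_mono hA (by linarith)
      simp only [hl, subst, if_neg h, if_pos he, if_neg h3]
      exact key _ _ 0 (left hA) hm₀ hge0 hC'

theorem reads_subst {t : ℝ} (ht : UnitIrrational t) {p : SplitPt} (hp : p ∈ subInterval t) :
    ∃ q ∈ subInterval t, Reads t p (subst t (letterOf (g t) (phi t p))) q ∧
      phi t q = rot (g t) 1 (phi t p) := by
  by_cases h : pq t 1 = 1
  · exact reads_subst_of_eq_one ht h hp
  by_cases he : Even (pq t 1)
  · exact reads_subst_of_even ht he hp
  · exact reads_subst_of_odd ht h he hp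

theorem reads_extend_subst {t : ℝ} (ht : UnitIrrational t) {p : SplitPt}
    (hp : p ∈ subInterval t) {w : Word} (hw : code (g t) (phi t p) w.length = w) :
    ∃ q ∈ subInterval t, Reads t p (extend (subst t) w) q := by
  induction w generalizing p with
  | nil => exact ⟨p, hp, Reads.nil (subInterval_subset ht hp)⟩
  | cons c w ih =>
    obtain ⟨h₁, h₂⟩ := Reads.of_append (v := [c]) (w := w) (by simpa using hw)
    obtain ⟨q, hq, hr, hφ⟩ := reads_subst ht hp
    have hc : letterOf (g t) (phi t p) = c := by
      simpa [code, rot_zero ((phi_mem ht).2 hp)] using h₁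
    rw [hc] at hr
    obtain ⟨q', hq', hr'⟩ := ih hq (by rw [hφ]; exact h₂)
    exact ⟨q', hq', hr.append hr'⟩

/-! ### Words and iterated substitutions -/

theorem extend_append (s : Letter → Word) (u v : Word) :
    extend s (u ++ v) = extend s u ++ extend s v :=
  List.flatMap_append

theorem extend_singleton (s : Letter → Word) (c : Letter) : extend s [c] = s c :=
  List.flatMap_singleton s c

theorem extend_cons (s : Letter → Word) (c : Letter) (w : Word) :
    extend s (c :: w) = s c ++ extend s w :=
  List.flatMap_cons

theorem blk_succ (i j : ℕ) : blk (i + 1) j = Letter.A :: blk i j := by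
  simp [blk, List.replicate_succ]

theorem subst_of_eq_one {t : ℝ} (h : pq t 1 = 1) : subst t = fun c => [c] := by
  simp only [subst, if_pos h]

theorem subst_eq_cons {t : ℝ} (ht : UnitIrrational t) (h : pq t 1 ≠ 1) (c : Letter) :
    ∃ w, subst t c = Letter.A :: w := by
  obtain ⟨k, hk⟩ : ∃ k, pq t 1 / 2 = k + 1 := ⟨pq t 1 / 2 - 1, by have := two_le_pq ht h; omega⟩
  simp only [subst, if_neg h, hk]
  split_ifs <;> cases c <;> simp only [blk_succ, List.cons_append] <;> exact ⟨_, rfl⟩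

/-- The letter `A` starts its own image and is followed by something, so the iterated images of `A`
form a chain whose lengths grow without bound. -/
theorem subst_A_eq_cons {t : ℝ} (ht : UnitIrrational t) (h : pq t 1 ≠ 1) :
    ∃ w, w ≠ [] ∧ subst t Letter.A = Letter.A :: w := by
  obtain ⟨k, hk⟩ : ∃ k, pq t 1 / 2 = k + 1 := ⟨pq t 1 / 2 - 1, by have := two_le_pq ht h; omega⟩
  simp only [subst, if_neg h, hk]
  split_ifs <;> simp only [blk_succ, List.cons_append] <;> refine ⟨_, ?_, rfl⟩ <;>
    simp [blk]

theorem subst_ne_id_iff {t : ℝ} (ht : UnitIrrational t) :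
    subst t ≠ (fun c => [c]) ↔ pq t 1 ≠ 1 := by
  refine ⟨fun h h' => h (subst_of_eq_one h'), fun h h' => ?_⟩
  obtain ⟨w, hw, e⟩ := subst_A_eq_cons ht h
  rw [h'] at e
  simp at e
  exact hw e

theorem subst_ne_nil {t : ℝ} (ht : UnitIrrational t) (c : Letter) : subst t c ≠ [] := by
  by_cases h : pq t 1 = 1
  · simp [subst_of_eq_one h]
  · obtain ⟨w, e⟩ := subst_eq_cons ht h c
    simp [e]

theorem extend_subst_of_eq_one {t : ℝ} (h : pq t 1 = 1) (w : Word) :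
    extend (subst t) w = w := by
  rw [subst_of_eq_one h, extend]; simp

theorem length_le_length_extend {s : Letter → Word} (hs : ∀ c, s c ≠ []) (w : Word) :
    w.length ≤ (extend s w).length := by
  induction w with
  | nil => simp
  | cons c w ih =>
    have := List.length_pos_iff.2 (hs c)
    rw [extend_cons, List.length_append, List.length_cons]
    omega

theorem frequently_pq_ne_one {t : ℝ} (ht : UnitIrrational t) :
    ∃ᶠ n in Filter.atTop, pq (thetaSeq t n) 1 ≠ 1 := by
  rw [Filter.frequently_atTop]
  intro N
  by_cases h : pq (thetaSeq t N) 1 = 1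
  · refine ⟨N + 1, by omega, ?_⟩
    rw [thetaSeq_succ]
    exact pq_g_ne_one (ht.thetaSeq N) h
  · exact ⟨N, le_rfl, h⟩

theorem frequently_subst_ne_id {t : ℝ} (ht : UnitIrrational t) :
    ∃ᶠ n in Filter.atTop, subst (thetaSeq t n) ≠ fun c => [c] :=
  (frequently_pq_ne_one ht).mono fun n hn => (subst_ne_id_iff (ht.thetaSeq n)).2 hn

theorem extend_subst_ne_nil {t : ℝ} (ht : UnitIrrational t) {w : Word} (hw : w ≠ []) :
    extend (subst t) w ≠ [] := by
  rw [← List.length_pos_iff] at hw ⊢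
  exact hw.trans_le (length_le_length_extend (subst_ne_nil ht) w)

theorem sigmaComp_succ (t : ℝ) (n : ℕ) (w : Word) :
    sigmaComp t (n + 1) w = sigmaComp t n (extend (subst (thetaSeq t n)) w) := rfl

theorem sigmaComp_append (t : ℝ) (n : ℕ) (u v : Word) :
    sigmaComp t n (u ++ v) = sigmaComp t n u ++ sigmaComp t n v := by
  induction n generalizing u v with
  | zero => rfl
  | succ n ih => simp only [sigmaComp_succ, extend_append, ih]

theorem sigmaComp_cons (t : ℝ) (n : ℕ) (c : Letter) (w : Word) :
    sigmaComp t n (c :: w) = sigmaComp t n [c] ++ sigmaComp t n w :=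
  sigmaComp_append t n [c] w

theorem length_le_length_sigmaComp {t : ℝ} (ht : UnitIrrational t) (n : ℕ) (w : Word) :
    w.length ≤ (sigmaComp t n w).length := by
  induction n generalizing w with
  | zero => exact le_rfl
  | succ n ih =>
    exact (length_le_length_extend (subst_ne_nil (ht.thetaSeq n)) w).trans (ih _)

theorem nested_succ (om : ℕ → Word) (s : ℕ → Letter → Word) (n : ℕ) (u : Word) :
    nested om s (n + 1) u = nested om s n (om n ++ extend (s n) u) := rfl

/-- The nested word is affine in `u`: a fixed prefix followed by the homomorphic image of `u`. -/
theorem nested_eq_append (t : ℝ) (om : ℕ → Word) (n : ℕ) (u : Word) :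
    nested om (fun m => subst (thetaSeq t m)) n u =
      nested om (fun m => subst (thetaSeq t m)) n [] ++ sigmaComp t n u := by
  induction n generalizing u with
  | zero => rfl
  | succ n ih =>
    rw [nested_succ, nested_succ, ih, ih (om n ++ extend _ []), sigmaComp_succ,
      sigmaComp_append, sigmaComp_append]
    simp [extend, show sigmaComp t n [] = [] from by
      have := congrArg List.length (sigmaComp_append t n [] [])
      rw [List.append_nil, List.length_append] at this
      exact List.length_eq_zero_iff.1 (by omega)]

theorem sigmaComp_A_prefix_succ {t : ℝ} (ht : UnitIrrational t) (n : ℕ) :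
    sigmaComp t n [Letter.A] <+: sigmaComp t (n + 1) [Letter.A] := by
  rw [sigmaComp_succ]
  by_cases h : pq (thetaSeq t n) 1 = 1
  · rw [extend_subst_of_eq_one h]
  · obtain ⟨w, -, e⟩ := subst_A_eq_cons (ht.thetaSeq n) h
    rw [extend_singleton, e, sigmaComp_cons t n _ w]
    exact List.prefix_append _ _

theorem sigmaComp_A_prefix {t : ℝ} (ht : UnitIrrational t) {m n : ℕ} (h : m ≤ n) :
    sigmaComp t m [Letter.A] <+: sigmaComp t n [Letter.A] := by
  induction n, h using Nat.le_induction with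
  | base => exact List.prefix_rfl
  | succ n _ ih => exact ih.trans (sigmaComp_A_prefix_succ ht n)

theorem exists_le_length_sigmaComp_A {t : ℝ} (ht : UnitIrrational t) (N : ℕ) :
    ∃ n, N ≤ (sigmaComp t n [Letter.A]).length := by
  induction N with
  | zero => exact ⟨0, Nat.zero_le _⟩
  | succ N ih =>
    obtain ⟨n, hn⟩ := ih
    obtain ⟨m, hm, h⟩ := Filter.frequently_atTop.1 (frequently_pq_ne_one ht) n
    obtain ⟨w, hw, e⟩ := subst_A_eq_cons (ht.thetaSeq m) h
    refine ⟨m + 1, ?_⟩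
    rw [sigmaComp_succ, extend_singleton, e, sigmaComp_cons, List.length_append]
    have h₁ := (sigmaComp_A_prefix ht hm).length_le
    have h₂ := length_le_length_sigmaComp ht m w
    have h₃ := List.length_pos_iff.2 hw
    omega

/-- Far down the hierarchy, the images of all nonempty words share a long prefix. -/
theorem exists_common_prefix {t : ℝ} (ht : UnitIrrational t) (N : ℕ) :
    ∃ v : Word, N ≤ v.length ∧ ∀ᶠ n in Filter.atTop, ∀ u : Word, u ≠ [] →
      v <+: sigmaComp t n u := by
  obtain ⟨n₀, hn₀⟩ := exists_le_length_sigmaComp_A ht N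
  obtain ⟨m, hm, h⟩ := Filter.frequently_atTop.1 (frequently_pq_ne_one ht) n₀
  refine ⟨_, hn₀, Filter.eventually_atTop.2 ⟨m + 1, fun n hn => ?_⟩⟩
  induction n, hn using Nat.le_induction with
  | base =>
    intro u hu
    obtain ⟨c, u, rfl⟩ := List.exists_cons_of_ne_nil hu
    obtain ⟨w, e⟩ := subst_eq_cons (ht.thetaSeq m) h c
    rw [sigmaComp_succ, extend_cons, e, List.cons_append, sigmaComp_cons t m _ (w ++ _)]
    exact (sigmaComp_A_prefix ht hm).trans (List.prefix_append _ _)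
  | succ n _ ih =>
    intro u hu
    exact ih _ (extend_subst_ne_nil (ht.thetaSeq n) hu)

/-! ### Reading the nested words -/

theorem getElem?_of_code {t : ℝ} {p : SplitPt} {w : Word} (h : code t p w.length = w) {i : ℕ}
    (hi : i < w.length) : w[i]? = some (letterOf t (rot t i p)) := by
  rw [← h]
  simp [code, hi]

theorem code_prefix {t : ℝ} {p : SplitPt} {v w : Word} (h : code t p w.length = w)
    (hv : v <+: w) : code t p v.length = v := by
  obtain ⟨u, rfl⟩ := hv
  exact (Reads.of_append h).1

/-- One level up, `ω_n` codes the steps to a point of `I'`, and from there the substituted word is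
read by `reads_extend_subst`. -/
theorem code_nested {t : ℝ} (ht : UnitIrrational t) {p : SplitPt} {τ : ℕ → ℕ}
    (hτ : Admissible t p τ) (n : ℕ) {w : Word}
    (hw : code (thetaSeq t n) (procPt t p τ n) w.length = w) :
    code t p (nested (omegaWord t p τ) (fun m => subst (thetaSeq t m)) n w).length =
      nested (omegaWord t p τ) (fun m => subst (thetaSeq t m)) n w := by
  induction n generalizing w with
  | zero => exact hw
  | succ n ih =>
    rw [nested_succ]
    apply ih
    rw [thetaSeq_succ] at hw
    obtain ⟨q, -, hq⟩ := reads_extend_subst (ht.thetaSeq n) (hτ n) hw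
    exact ((reads_code _ _ _).append hq).1

theorem convergesTo_nested {t : ℝ} (ht : UnitIrrational t) {p : SplitPt} {τ : ℕ → ℕ}
    (hτ : Admissible t p τ) {u : ℕ → Word} (hu : ∀ n, u n ≠ []) :
    ConvergesTo (fun n => nested (omegaWord t p τ) (fun m => subst (thetaSeq t m)) n (u n))
      (fun i => letterOf t (rot t i p)) := by
  intro i
  obtain ⟨v, hv, h⟩ := exists_common_prefix ht (i + 1)
  filter_upwards [h] with n hn
  obtain ⟨r, hr⟩ := hn _ (hu n)
  -- The word `u n` need not occur in any orbit. It is compared with the true first letter at level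
  -- `n`: both images start with `v`, and for the true letter the result is known to be a coding.
  set u' := code (thetaSeq t n) (procPt t p τ n) 1
  have hu' : u'.length = 1 := length_code _ _ _
  obtain ⟨r', hr'⟩ := hn u' (List.ne_nil_of_length_eq_add_one hu')
  have key := code_nested ht hτ n (w := u') (by rw [hu'])
  rw [nested_eq_append, ← hr', ← List.append_assoc] at key
  rw [nested_eq_append, ← hr, ← List.append_assoc,
    List.getElem?_append_left (by rw [List.length_append]; omega)]
  exact getElem?_of_code (code_prefix key (List.prefix_append _ _))
    (by rw [List.length_append]; omega)

theorem nested_nil_prefix_succ (t : ℝ) (om : ℕ → Word) (n : ℕ) :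
    nested om (fun m => subst (thetaSeq t m)) n [] <+:
      nested om (fun m => subst (thetaSeq t m)) (n + 1) [] := by
  rw [nested_succ, nested_eq_append t om n (om n ++ _)]
  exact List.prefix_append _ _

/-- A chain of words that starts a coding and lengthens infinitely often converges to it. -/
theorem isChainLimit_of_code {t : ℝ} {p : SplitPt} {w : ℕ → Word} (h : ∀ n, w n <+: w (n + 1))
    (hc : ∀ n, code t p (w n).length = w n) (hl : ∀ N, ∃ n, N ≤ (w n).length) :
    IsChainLimit w (fun i => letterOf t (rot t i p)) := by
  refine ⟨h, fun i => ?_⟩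
  obtain ⟨m, hm⟩ := hl (i + 1)
  refine Filter.eventually_atTop.2 ⟨m, fun n hn => getElem?_of_code (hc n) ?_⟩
  have : w m <+: w n := by
    induction n, hn using Nat.le_induction with
    | base => exact List.prefix_rfl
    | succ n _ ih => exact ih.trans (h n)
  have := this.length_le
  omega

theorem isChainLimit_nested {t : ℝ} (ht : UnitIrrational t) {p : SplitPt} {τ : ℕ → ℕ}
    (hτ : Admissible t p τ) (hω : ∃ᶠ n in Filter.atTop, omegaWord t p τ n ≠ []) :
    IsChainLimit (fun n => nested (omegaWord t p τ) (fun m => subst (thetaSeq t m)) n [])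
      (fun i => letterOf t (rot t i p)) := by
  have hmono := nested_nil_prefix_succ t (omegaWord t p τ)
  refine isChainLimit_of_code hmono (fun n => code_nested ht hτ n rfl) fun N => ?_
  induction N with
  | zero => exact ⟨0, Nat.zero_le _⟩
  | succ N ih =>
    obtain ⟨n, hn⟩ := ih
    obtain ⟨m, hm, h⟩ := Filter.frequently_atTop.1 hω n
    refine ⟨m + 1, ?_⟩
    have h₁ : nested (omegaWord t p τ) (fun m => subst (thetaSeq t m)) n [] <+:
        nested (omegaWord t p τ) (fun m => subst (thetaSeq t m)) m [] := by
      clear h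
      induction m, hm using Nat.le_induction with
      | base => exact List.prefix_rfl
      | succ m _ ih => exact ih.trans (hmono m)
    have h₂ := h₁.length_le
    have h₃ := length_le_length_sigmaComp ht m (omegaWord t p τ m)
    have h₄ := List.length_pos_iff.2 h
    rw [nested_succ, nested_eq_append, List.length_append]
    simp only [extend, List.flatMap_nil, List.append_nil]
    omega

/-! ### Codings of split points and of points of the circle -/

theorem letterOf_eq_iff {t : ℝ} (ht : UnitIrrational t) {p : SplitPt} (hp : p ∈ splitIcc 0 1)
    (c : Letter) : letterOf t p = c ↔ p ∈ splitIcc (ends t c).1 (ends t c).2 := by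
  rw [mem_splitIcc] at hp
  rcases lt_or_gt_of_ne (show t ≠ 1 / 2 by
    rintro h
    exact ht.irrational ⟨1 / 2, by rw [h]; push_cast; rfl⟩) with h | h
  · obtain ⟨eA, eB, eC⟩ := ends_of_lt h
    constructor
    · rintro rfl
      by_cases h₁ : p.Ge (1 / 2)
      · by_cases h₂ : p.Ge (1 - t)
        · rw [letterOf_C h h₂, eC]; exact mem_splitIcc.2 ⟨h₂, hp.2⟩
        · rw [letterOf_B h h₁ h₂, eB]; exact mem_splitIcc.2 ⟨h₁, h₂⟩
      · rw [letterOf_A h hp.1 h₁, eA]; exact mem_splitIcc.2 ⟨hp.1, h₁⟩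
    · cases c <;> intro hc <;> rw [mem_splitIcc] at hc
      · rw [eA] at hc; exact letterOf_A h hc.1 hc.2
      · rw [eB] at hc; exact letterOf_B h hc.1 hc.2
      · rw [eC] at hc; exact letterOf_C h hc.1
  · obtain ⟨eC, eB, eA⟩ := ends_of_gt h
    constructor
    · rintro rfl
      by_cases h₁ : p.Ge (1 / 2)
      · rw [letterOf_A' h h₁ hp.2, eA]; exact mem_splitIcc.2 ⟨h₁, hp.2⟩
      · by_cases h₂ : p.Ge (1 - t)
        · rw [letterOf_B' h h₂ h₁, eB]; exact mem_splitIcc.2 ⟨h₂, h₁⟩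
        · rw [letterOf_C' h h₂, eC]; exact mem_splitIcc.2 ⟨hp.1, h₂⟩
    · cases c <;> intro hc <;> rw [mem_splitIcc] at hc
      · rw [eA] at hc; exact letterOf_A' h hc.1 hc.2
      · rw [eB] at hc; exact letterOf_B' h hc.1 hc.2
      · rw [eC] at hc; exact letterOf_C' h hc.2

/-- The copy of `x ∈ [0,1)` on the given side. -/
noncomputable def lift (s : Side) (x : ℝ) : SplitPt :=
  match s with
  | Side.plus => ⟨x, Side.plus⟩
  | Side.minus => ⟨if x = 0 then 1 else x, Side.minus⟩

theorem isLift_iff {x : ℝ} {p : SplitPt} : IsLift x p ↔ p = lift p.side x := by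
  rcases p with ⟨y, _ | _⟩ <;> simp [IsLift, lift]

theorem lift_mem {x : ℝ} (hx : x ∈ Set.Ico (0 : ℝ) 1) (s : Side) : lift s x ∈ splitIcc 0 1 := by
  cases s
  · exact hx
  · by_cases h : x = 0
    · simp [lift, splitIcc, h]
    · simp only [lift, splitIcc, if_neg h]
      exact ⟨lt_of_le_of_ne hx.1 (Ne.symm h), hx.2.le⟩

theorem lift_pos_eq (s : Side) (x : ℝ) : ∃ e : ℤ, (lift s x).pos = x + e := by
  cases s
  · exact ⟨0, by simp [lift]⟩
  · by_cases h : x = 0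
    · exact ⟨1, by simp [lift, h]⟩
    · exact ⟨0, by simp [lift, h]⟩

theorem fract_mem_Ico (x : ℝ) : Int.fract x ∈ Set.Ico (0 : ℝ) 1 :=
  ⟨Int.fract_nonneg x, Int.fract_lt_one x⟩

theorem rot_lift (θ : ℝ) (s : Side) (x : ℝ) (i : ℕ) :
    rot (Int.fract θ) i (lift s x) = lift s (Int.fract (x + i * θ)) := by
  set y := Int.fract (x + i * θ) with hy
  obtain ⟨e, he⟩ := lift_pos_eq s x
  obtain ⟨e', he'⟩ := lift_pos_eq s y
  have h : lift s y = (lift s x).shift ((lift s y).pos - (lift s x).pos) := by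
    cases s <;> simp [SplitPt.shift, lift]
  have hm := lift_mem (fract_mem_Ico (x + i * θ)) s
  rw [← hy, h] at hm
  rw [h]
  -- The integer accounts for reducing `θ` and `x + i * θ` modulo `1`, and for `e`, `e'`, which are
  -- `1` exactly where the left copy of `0` sits at position `1`.
  refine rot_eq_of_mem (⌊x + i * θ⌋ - i * ⌊θ⌋ + e - e') ?_ hm
  rw [he, he', hy, Int.fract, Int.fract]
  push_cast
  ring

/-- The partition of the circle induced by the split partition on the copies of one side. -/
def sidePart (t : ℝ) (s : Side) (c : Letter) : Set ℝ :=
  {y | y ∈ Set.Ico (0 : ℝ) 1 ∧ letterOf t (lift s y) = c}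

theorem ends_bounds {t : ℝ} (ht : UnitIrrational t) (c : Letter) :
    0 ≤ (ends t c).1 ∧ (ends t c).2 ≤ 1 := by
  have h₀ := ht.pos
  have h₁ := ht.lt_one
  unfold ends
  split_ifs <;> cases c <;> constructor <;> dsimp only <;> linarith

/-- An orbit in the split circle stays on one side, so its coding is exact for the partition seen
from that side; only the ownership of endpoints changes, with `0` treated as `1` on the left. -/
theorem isEndpointChange_sidePart {t : ℝ} (ht : UnitIrrational t) (s : Side) :
    IsEndpointChange t (sidePart t s) := by
  refine ⟨fun c => ⟨fun y hy => ?_, fun y hy => ?_⟩,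
    fun y hy => ⟨_, ⟨hy, rfl⟩, fun c h => h.2.symm⟩⟩
  · obtain ⟨h₀, h₁⟩ := ends_bounds ht c
    have hy' : y ∈ Set.Ico (0 : ℝ) 1 := ⟨h₀.trans hy.1.le, hy.2.trans_le h₁⟩
    refine ⟨hy', (letterOf_eq_iff ht (lift_mem hy' s) c).2 ?_⟩
    cases s
    · exact ⟨hy.1.le, hy.2⟩
    · have : y ≠ 0 := (h₀.trans_lt hy.1).ne'
      simp only [lift, if_neg this]
      exact ⟨hy.1, hy.2.le⟩
  · refine ⟨hy.1, ?_⟩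
    have h := (letterOf_eq_iff ht (lift_mem hy.1 s) c).1 hy.2
    cases s
    · exact Or.inl ⟨h.1, h.2.le⟩
    · by_cases h₀ : y = 0
      · simp only [lift, if_pos h₀] at h
        exact Or.inr ⟨h₀, le_antisymm (ends_bounds ht c).2 h.2⟩
      · simp only [lift, if_neg h₀] at h
        exact Or.inl ⟨h.1.le, h.2⟩

theorem sidePart_plus {t : ℝ} (ht : UnitIrrational t) : sidePart t Side.plus = arc t := by
  ext c y
  constructor
  · exact fun h => (letterOf_eq_iff ht (lift_mem h.1 _) c).1 h.2
  · intro h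
    obtain ⟨h₀, h₁⟩ := ends_bounds ht c
    have hy' : y ∈ Set.Ico (0 : ℝ) 1 := ⟨h₀.trans h.1, h.2.trans_le h₁⟩
    exact ⟨hy', (letterOf_eq_iff ht (lift_mem hy' _) c).2 h⟩

theorem encodes_sidePart {θ x : ℝ} (s : Side) :
    Encodes (sidePart (Int.fract θ) s) θ x
      (fun i => letterOf (Int.fract θ) (rot (Int.fract θ) i (lift s x))) := by
  intro i c
  dsimp only
  rw [rot_lift]
  exact ⟨fun h => ⟨fract_mem_Ico _, h⟩, fun h => h.2⟩

theorem mem_sidePart_iff_mem_arc {t y : ℝ} (ht : UnitIrrational t) (s : Side) (h₀ : y ≠ 0)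
    (h₁ : y ≠ 1 / 2) (h₂ : y ≠ 1 - t) (c : Letter) : y ∈ sidePart t s c ↔ y ∈ arc t c := by
  by_cases hy : y ∈ Set.Ico (0 : ℝ) 1
  · rw [← sidePart_plus ht]
    simp only [sidePart, Set.mem_ofPred_eq, hy, true_and]
    rw [letterOf_eq_iff ht (lift_mem hy _), letterOf_eq_iff ht (lift_mem hy _)]
    cases s
    · rfl
    · simp only [lift, if_neg h₀, splitIcc, Set.mem_ofPred_eq]
      have h₃ : y ≠ 1 := hy.2.ne
      have e₁ : y ≠ (ends t c).1 := by
        unfold ends; split_ifs <;> cases c <;> assumption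
      have e₂ : y ≠ (ends t c).2 := by
        unfold ends; split_ifs <;> cases c <;> assumption
      exact ⟨fun h => ⟨h.1.le, lt_of_le_of_ne h.2 e₂⟩,
        fun h => ⟨lt_of_le_of_ne h.1 e₁.symm, h.2.le⟩⟩
  · refine ⟨fun h => absurd h.1 hy, fun h => absurd ?_ hy⟩
    rw [← sidePart_plus ht] at h
    exact h.1

/-- Half-integers are allowed so that the endpoint `1/2` is covered along with `0` and `1 - t`. -/
theorem eq_zero_of_irrational_mul {θ : ℝ} (hθ : Irrational θ) {a b : ℤ}
    (h : (a : ℝ) * θ = b / 2) : a = 0 ∧ b = 0 := by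
  have ha : a = 0 := by
    by_contra ha
    refine (hθ.intCast_mul ha) ⟨b / 2, ?_⟩
    rw [h]; push_cast; rfl
  refine ⟨ha, ?_⟩
  rw [ha] at h
  have : (b : ℝ) = 0 := by push_cast at h; linarith
  exact_mod_cast this

theorem orbit_injective {θ : ℝ} (hθ : Irrational θ) {x : ℝ} {i j : ℕ}
    (h : Int.fract (x + i * θ) = Int.fract (x + j * θ)) : i = j := by
  obtain ⟨m, hm⟩ := Int.fract_eq_fract.1 h
  have := (eq_zero_of_irrational_mul hθ (a := i - j) (b := 2 * m) (by
    push_cast; linarith)).1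
  omega

theorem encodesUpToEndpoints_of_lift {θ x : ℝ} (hθ : Irrational θ) (s : Side) :
    EncodesUpToEndpoints θ x
      (fun i => letterOf (Int.fract θ) (rot (Int.fract θ) i (lift s x))) := by
  have ht := unitIrrational_fract hθ
  refine ⟨?_, _, isEndpointChange_sidePart ht s, encodes_sidePart s⟩
  set E := {i | ¬ EncodesAt (arc (Int.fract θ)) θ x
    (fun i => letterOf (Int.fract θ) (rot (Int.fract θ) i (lift s x))) i}
  have hE : ∀ i ∈ E, Int.fract (x + i * θ) = 0 ∨ Int.fract (x + i * θ) = 1 / 2 ∨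
      Int.fract (x + i * θ) = 1 - Int.fract θ := by
    intro i hi
    by_contra! h
    refine hi fun c => ?_
    rw [encodes_sidePart s i c]
    exact mem_sidePart_iff_mem_arc ht s h.1 h.2.1 h.2.2 c
  have sub : ∀ a : ℝ, {i : ℕ | Int.fract (x + i * θ) = a}.encard ≤ 1 := fun a =>
    Set.encard_le_one_iff.2 fun i j hi hj => orbit_injective hθ (hi.trans hj.symm)
  -- An orbit through `1/2` avoids `0` and `1 - t`: otherwise an integer multiple of `θ` would be an
  -- integer plus `1/2`. So the possible error times are one visit to `1/2`, or at most one visit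
  -- each to `0` and `1 - t`.
  by_cases hj : ∃ j : ℕ, Int.fract (x + j * θ) = 1 / 2
  · obtain ⟨j, hj⟩ := hj
    refine (Set.encard_le_encard (t := {i : ℕ | Int.fract (x + i * θ) = 1 / 2}) ?_).trans
      ((sub _).trans (by norm_num))
    intro i hi
    rcases hE i hi with h | h | h
    · exfalso
      rw [Int.fract] at h hj
      have := (eq_zero_of_irrational_mul hθ (a := j - i)
        (b := 1 + 2 * ⌊x + j * θ⌋ - 2 * ⌊x + i * θ⌋) (by push_cast; linarith)).2
      omega
    · exact h
    · exfalso
      rw [Int.fract] at h hj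
      rw [Int.fract] at h
      have := (eq_zero_of_irrational_mul hθ (a := j - i - 1)
        (b := 1 + 2 * ⌊x + j * θ⌋ - 2 * ⌊x + i * θ⌋ - 2 - 2 * ⌊θ⌋) (by push_cast; linarith)).2
      omega
  · have : E ⊆ {i : ℕ | Int.fract (x + i * θ) = 0} ∪
        {i : ℕ | Int.fract (x + i * θ) = 1 - Int.fract θ} := by
      intro i hi
      rcases hE i hi with h | h | h
      · exact Or.inl h
      · exact absurd ⟨i, h⟩ hj
      · exact Or.inr h
    calc E.encard ≤ _ := Set.encard_le_encard this
      _ ≤ _ := Set.encard_union_le _ _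
      _ ≤ 1 + 1 := add_le_add (sub _) (sub _)
      _ = 2 := by norm_num

/-! ### Recurrence to the subinterval -/

theorem exists_least {P : ℕ → Prop} (h₀ : ¬ P 0) (h : ∃ n, P n) : ∃ n, ¬ P n ∧ P (n + 1) := by
  by_contra! H
  obtain ⟨n, hn⟩ := h
  have : ∀ n, ¬ P n := fun n => Nat.rec h₀ (fun k hk => H k hk) n
  exact this n hn

theorem exists_ge_mul {δ : ℝ} (hδ : 0 < δ) {p : SplitPt} (h : p.Ge 0) :
    ∃ n : ℕ, p.Ge (n * δ) ∧ ¬ p.Ge ((n + 1) * δ) := by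
  obtain ⟨m, hm⟩ := exists_nat_gt (p.pos / δ)
  rw [div_lt_iff₀ hδ] at hm
  obtain ⟨n, hn, hn'⟩ := exists_least (P := fun n : ℕ => ¬ p.Ge (n * δ)) (by simpa using h)
    ⟨m, fun h' => h'.le.not_gt hm⟩
  exact ⟨n, not_not.1 hn, by simpa using hn'⟩

/-- For even `a₁`, each group of `2k` steps moves by `-δ` modulo `1`, so a point in the `n`-th
interval of length `δ` reaches `I'` after `n` groups. For odd `a₁ ≠ 1`, `t < δ`, so a step past `1`
cannot jump over `I'`. Requiring `j ≥ 1` makes every `ω_n` nonempty. -/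
theorem exists_rot_mem_subInterval {t : ℝ} (ht : UnitIrrational t) (p : SplitPt) :
    ∃ j, 1 ≤ j ∧ rot t j p ∈ subInterval t := by
  suffices ∃ j, rot t j (rot t 1 p) ∈ subInterval t by
    obtain ⟨j, hj⟩ := this
    exact ⟨1 + j, by omega, by rwa [rot_rot] at hj⟩
  have hq := rot_mem t 1 p
  generalize rot t 1 p = q at hq
  have hq' := mem_splitIcc.1 hq
  have ht₀ := ht.pos
  by_cases h : pq t 1 = 1
  · exact ⟨0, by rwa [rot_zero hq, subInterval, delta_of_eq_one h]⟩
  suffices ∃ (j : ℕ) (m : ℤ), q.shift (j * t - m) ∈ subInterval t by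
    obtain ⟨j, m, hj⟩ := this
    exact ⟨j, by rwa [rot_eq_of_mem m rfl (subInterval_subset ht hj)]⟩
  simp only [subInterval, mem_splitIcc, SplitPt.shift_ge]
  by_cases he : Even (pq t 1)
  · obtain ⟨n, hn, hn'⟩ := exists_ge_mul (delta_pos ht) hq'.1
    have hδ := delta_eq t
    refine ⟨2 * (pq t 1 / 2) * n, n, hn.mono ?_, SplitPt.not_ge_mono hn' ?_⟩ <;>
      push_cast <;> rw [hδ] <;> linarith
  · have htδ : t < delta t := by
      rw [(delta_of_odd ht h he).1]; nlinarith [ht.gauss.pos]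
    obtain ⟨m, hm⟩ := exists_nat_gt ((1 - q.pos + 1) / t)
    rw [div_lt_iff₀ ht₀] at hm
    obtain ⟨n, hn, hn'⟩ := exists_least (P := fun n : ℕ => q.Ge (1 - n * t))
      (by simpa using hq'.2) ⟨m, by
        by_contra h'
        have := SplitPt.le_of_not_ge h'
        have := hq'.1.le
        linarith⟩
    refine ⟨n + 1, 1, hn'.mono ?_, SplitPt.not_ge_mono hn ?_⟩ <;> push_cast <;> linarith

theorem exists_admissible {t : ℝ} (ht : UnitIrrational t) (p : SplitPt) :
    ∃ τ : ℕ → ℕ, Admissible t p τ ∧ ∃ᶠ n in Filter.atTop, omegaWord t p τ n ≠ [] := by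
  choose τ hτ₁ hτ using fun (n : ℕ) (q : SplitPt) =>
    exists_rot_mem_subInterval (ht.thetaSeq n) q
  let q : ℕ → SplitPt := fun n => Nat.rec p (fun n q => phi (thetaSeq t n)
    (rot (thetaSeq t n) (τ n q) q)) n
  have hq : ∀ n, procPt t p (fun n => τ n (q n)) n = q n := by
    intro n
    induction n with
    | zero => rfl
    | succ n ih => rw [procPt, ih]
  refine ⟨fun n => τ n (q n), fun n => by rw [hq]; exact hτ n (q n), ?_⟩
  refine (Filter.Eventually.of_forall fun n => ?_).frequently
  have := hτ₁ n (q n)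
  rw [← List.length_pos_iff]
  simp only [omegaWord, List.length_map, List.length_range]
  omega

/-! ### The point whose process never moves -/

/-- The inverse of `φ` on positions. -/
noncomputable def phiInv (t y : ℝ) : ℝ := if pq t 1 = 1 then 1 - y else y * delta t

theorem phiInv_mem {t : ℝ} (ht : UnitIrrational t) {y : ℝ} (hy : y ∈ Set.Icc (0 : ℝ) 1) :
    phiInv t y ∈ Set.Icc (0 : ℝ) 1 := by
  have h₀ := delta_pos ht
  have h₁ := delta_le_one ht
  obtain ⟨hy₀, hy₁⟩ := hy
  unfold phiInv
  split_ifs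
  · exact ⟨by linarith, by linarith⟩
  · exact ⟨by positivity, by nlinarith⟩

theorem continuous_phiInv (t : ℝ) : Continuous (phiInv t) := by
  unfold phiInv
  split_ifs <;> fun_prop

theorem phiInv_injective {t : ℝ} (ht : UnitIrrational t) : Function.Injective (phiInv t) := by
  have h₀ := (delta_pos ht).ne'
  intro x y h
  unfold phiInv at h
  split_ifs at h
  · linarith
  · exact mul_right_cancel₀ h₀ h

/-- The composition of the first `n` inverse maps. -/
noncomputable def phiInvComp (t : ℝ) : ℕ → ℝ → ℝ
  | 0 => id
  | n + 1 => phiInvComp t n ∘ phiInv (thetaSeq t n)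

theorem continuous_phiInvComp (t : ℝ) (n : ℕ) : Continuous (phiInvComp t n) := by
  induction n with
  | zero => exact continuous_id
  | succ n ih => exact ih.comp (continuous_phiInv _)

theorem phiInvComp_injective {t : ℝ} (ht : UnitIrrational t) (n : ℕ) :
    Function.Injective (phiInvComp t n) := by
  induction n with
  | zero => exact Function.injective_id
  | succ n ih => exact ih.comp (phiInv_injective (ht.thetaSeq n))

/-- Cantor's intersection theorem for the decreasing compact images of `[0, 1]`; the preimages of a
common point under the injective compositions form the orbit. Sides are ignored here. -/
theorem exists_backward_orbit {t : ℝ} (ht : UnitIrrational t) :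
    ∃ z : ℕ → ℝ, ∀ n, z n ∈ Set.Icc (0 : ℝ) 1 ∧ z n = phiInv (thetaSeq t n) (z (n + 1)) := by
  have hc : ∀ n, IsCompact (phiInvComp t n '' Set.Icc 0 1) := fun n =>
    isCompact_Icc.image (continuous_phiInvComp t n)
  obtain ⟨x, hx⟩ := IsCompact.nonempty_iInter_of_sequence_nonempty_isCompact_isClosed
    (fun n => phiInvComp t n '' Set.Icc 0 1)
    (fun n => by
      rintro _ ⟨y, hy, rfl⟩
      exact ⟨_, phiInv_mem (ht.thetaSeq n) hy, rfl⟩)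
    (fun n => ⟨_, 0, by simp, rfl⟩) (hc 0) (fun n => (hc n).isClosed)
  rw [Set.mem_iInter] at hx
  choose z hz hzx using hx
  refine ⟨z, fun n => ⟨hz n, phiInvComp_injective ht n ?_⟩⟩
  rw [hzx n, ← hzx (n + 1)]
  rfl

theorem phi_phiInv {t : ℝ} (ht : UnitIrrational t) (y : ℝ) (s : Side) :
    phi t ⟨phiInv t y, s⟩ = ⟨y, if pq t 1 = 1 then s.flip else s⟩ := by
  have := (delta_pos ht).ne'
  unfold phi phiInv
  split_ifs
  · simp
  · simp [this]

theorem admissible_zero_mem {t : ℝ} (ht : UnitIrrational t) {p : SplitPt}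
    (hp : p ∈ splitIcc 0 1) (h : Admissible t p fun _ => 0) (n : ℕ) :
    procPt t p (fun _ => 0) n ∈ splitIcc 0 1 := by
  cases n with
  | zero => exact hp
  | succ n => exact (phi_mem (ht.thetaSeq n)).2 (h n)

theorem exists_admissible_zero {t : ℝ} (ht : UnitIrrational t) :
    ∃ p ∈ splitIcc 0 1, Admissible t p fun _ => 0 := by
  obtain ⟨z, hz⟩ := exists_backward_orbit ht
  let sd : Side → ℕ → Side := fun s n =>
    Nat.rec s (fun n s => if pq (thetaSeq t n) 1 = 1 then s.flip else s) n
  -- Both choices of the initial side are followed in parallel, and they remain opposite at each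
  -- level.
  have hsd : ∀ n, sd Side.minus n = (sd Side.plus n).flip := by
    intro n
    induction n with
    | zero => rfl
    | succ n ih =>
      change (if _ then (sd Side.minus n).flip else sd Side.minus n) =
        Side.flip (if _ then (sd Side.plus n).flip else sd Side.plus n)
      rw [ih]
      split_ifs <;> rfl
  have hφ : ∀ s n, phi (thetaSeq t n) ⟨z n, sd s n⟩ = ⟨z (n + 1), sd s (n + 1)⟩ := by
    intro s n
    rw [(hz n).2, phi_phiInv (ht.thetaSeq n)]
  have hback : ∀ s m n, m ≤ n → (⟨z n, sd s n⟩ : SplitPt) ∈ splitIcc 0 1 →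
      (⟨z m, sd s m⟩ : SplitPt) ∈ splitIcc 0 1 := by
    intro s m n hmn
    induction n, hmn using Nat.le_induction with
    | base => exact id
    | succ n _ ih =>
      intro h
      rw [← hφ, phi_mem (ht.thetaSeq n)] at h
      exact ih (subInterval_subset (ht.thetaSeq n) h)
  -- By `hback` a failure at one level persists at all later ones. If both sides failed, both would
  -- fail at a common level, where they are the two copies of a number in `[0, 1]`; but at least one
  -- such copy lies in the circle.
  obtain ⟨s, hs⟩ : ∃ s, ∀ n, (⟨z n, sd s n⟩ : SplitPt) ∈ splitIcc 0 1 := by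
    by_contra! H
    obtain ⟨m, hm⟩ := H Side.plus
    obtain ⟨n, hn⟩ := H Side.minus
    have h₁ := fun h => hm (hback _ _ _ (le_max_left m n) h)
    have h₂ := fun h => hn (hback _ _ _ (le_max_right m n) h)
    rw [hsd] at h₂
    obtain ⟨h₃, h₄⟩ := (hz (max m n)).1
    rcases h₃.eq_or_lt with h₃ | h₃
    · cases h : sd Side.plus (max m n) <;> rw [h] at h₁ h₂
      · exact h₁ ⟨h₃.le, by dsimp only; linarith⟩
      · exact h₂ ⟨h₃.le, by dsimp only; linarith⟩
    · rcases h₄.eq_or_lt with h₄ | h₄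
      · cases h : sd Side.plus (max m n) <;> rw [h] at h₁ h₂
        · exact h₂ ⟨h₃, h₄.le⟩
        · exact h₁ ⟨h₃, h₄.le⟩
      · cases h : sd Side.plus (max m n) <;> rw [h] at h₁ h₂
        · exact h₁ ⟨h₃.le, h₄⟩
        · exact h₂ ⟨h₃.le, h₄⟩
  have hproc : ∀ n, procPt t ⟨z 0, s⟩ (fun _ => 0) n = ⟨z n, sd s n⟩ := by
    intro n
    induction n with
    | zero => rfl
    | succ n ih => rw [procPt, ih, rot_zero (hs n), hφ]
  refine ⟨⟨z 0, s⟩, hs 0, fun n => ?_⟩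
  rw [hproc, rot_zero (hs n), ← phi_mem (ht.thetaSeq n), hφ]
  exact hs (n + 1)

theorem abs_phi_pos_sub {t : ℝ} (ht : UnitIrrational t) (p q : SplitPt) :
    |(phi t p).pos - (phi t q).pos| * delta t = |p.pos - q.pos| := by
  have := delta_pos ht
  by_cases h : pq t 1 = 1
  · rw [delta_of_eq_one h, mul_one, phi, phi, if_pos h, if_pos h, abs_sub_comm p.pos]
    congr 1; ring
  · rw [phi, phi, if_neg h, if_neg h]
    dsimp only
    rw [← sub_div, abs_div, abs_of_pos this]
    field_simp

/-- Each `φ` divides distances by `δ ≤ 1`, and infinitely often by `δ ≤ 1/2`; distances in the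
circle stay at most `1`, so the initial distance is zero. -/
theorem admissible_zero_pos_unique {t : ℝ} (ht : UnitIrrational t) {p q : SplitPt}
    (hp : p ∈ splitIcc 0 1) (hq : q ∈ splitIcc 0 1) (hp' : Admissible t p fun _ => 0)
    (hq' : Admissible t q fun _ => 0) : p.pos = q.pos := by
  set d : ℕ → ℝ := fun n =>
    |(procPt t p (fun _ => 0) n).pos - (procPt t q (fun _ => 0) n).pos| with hd
  have hmp := admissible_zero_mem ht hp hp'
  have hmq := admissible_zero_mem ht hq hq'
  have hd₁ : ∀ n, d n ≤ 1 := by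
    intro n
    obtain ⟨h₁, h₂⟩ := mem_splitIcc.1 (hmp n)
    obtain ⟨h₃, h₄⟩ := mem_splitIcc.1 (hmq n)
    rw [hd, abs_le]
    constructor <;> linarith [h₁.le, h₃.le, SplitPt.le_of_not_ge h₂, SplitPt.le_of_not_ge h₄]
  have hds : ∀ n, d (n + 1) * delta (thetaSeq t n) = d n := by
    intro n
    simp only [hd]
    rw [procPt, procPt, rot_zero (hmp n), rot_zero (hmq n), abs_phi_pos_sub (ht.thetaSeq n)]
  have hd₀ : ∀ n, 0 ≤ d n := fun n => abs_nonneg _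
  have hmono : Monotone d := monotone_nat_of_le_succ fun n => by
    have := hds n
    nlinarith [hd₀ (n + 1), delta_le_one (ht.thetaSeq n)]
  have hgrow : ∀ N, ∃ n, 2 ^ N * d 0 ≤ d n := by
    intro N
    induction N with
    | zero => exact ⟨0, by simp⟩
    | succ N ih =>
      obtain ⟨n, hn⟩ := ih
      obtain ⟨m, hm, h⟩ := Filter.frequently_atTop.1 (frequently_pq_ne_one ht) n
      refine ⟨m + 1, ?_⟩
      have h₁ := hds m
      have h₂ := delta_le_half (ht.thetaSeq m) h
      have h₃ := hmono hm
      have h₄ := hd₀ (m + 1)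
      rw [pow_succ]
      nlinarith
  by_contra hne
  have hpos : 0 < d 0 := abs_pos.2 (sub_ne_zero.2 hne)
  obtain ⟨N, hN⟩ := pow_unbounded_of_one_lt (1 / d 0) one_lt_two
  obtain ⟨n, hn⟩ := hgrow N
  rw [div_lt_iff₀ hpos] at hN
  linarith [hd₁ n]

theorem IsLift.mem {x : ℝ} (hx : x ∈ Set.Ico (0 : ℝ) 1) {p : SplitPt} (h : IsLift x p) :
    p ∈ splitIcc 0 1 := by
  rw [isLift_iff.1 h]; exact lift_mem hx _

theorem exists_isLift {p : SplitPt} (hp : p ∈ splitIcc 0 1) :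
    ∃ x ∈ Set.Ico (0 : ℝ) 1, IsLift x p := by
  rcases p with ⟨x, _ | _⟩
  · exact ⟨x, hp, rfl⟩
  · obtain ⟨h₀, h₁⟩ := hp
    dsimp only at h₀ h₁
    rcases h₁.eq_or_lt with h | h
    · exact ⟨0, by simp, by simp [IsLift, h]⟩
    · exact ⟨x, ⟨h₀.le, h⟩, by simp [IsLift, h₀.ne']⟩

theorem IsLift.eq_of_pos_eq {x y : ℝ} (hx : x ∈ Set.Ico (0 : ℝ) 1) (hy : y ∈ Set.Ico (0 : ℝ) 1)
    {p q : SplitPt} (hp : IsLift x p) (hq : IsLift y q) (h : p.pos = q.pos) : x = y := by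
  have h₁ := hx.2
  have h₂ := hy.2
  rw [isLift_iff] at hp hq
  rw [hp, hq] at h
  rcases p with ⟨p, _ | _⟩ <;> rcases q with ⟨q, _ | _⟩ <;> simp only [lift] at h <;>
    (try split_ifs at h) <;> linarith

/-! ### The orbit of zero -/

/-- The right copy of zero. -/
noncomputable def zeroPlus : SplitPt := ⟨0, Side.plus⟩

theorem zeroPlus_ge {a : ℝ} : zeroPlus.Ge a ↔ a ≤ 0 := Iff.rfl

theorem zeroPlus_mem_splitIcc {b : ℝ} (hb : 0 < b) : zeroPlus ∈ splitIcc 0 b := ⟨le_rfl, hb⟩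

theorem phi_zeroPlus {t : ℝ} (h : pq t 1 ≠ 1) : phi t zeroPlus = zeroPlus := by
  simp [phi, if_neg h, zeroPlus]

theorem ends_one_sub {t : ℝ} (h : 1 / 2 < t) (c : Letter) :
    ends (1 - t) c = (1 - (ends t c).2, 1 - (ends t c).1) := by
  obtain ⟨eC, eB, eA⟩ := ends_of_gt h
  obtain ⟨eA', eB', eC'⟩ := ends_of_lt (t := 1 - t) (by linarith)
  cases c
  · rw [eA', eA]; norm_num
  · rw [eB', eB]; norm_num
  · rw [eC', eC]; norm_num

/-- The reflection `y ↦ 1 - y` matches the orbits and the partitions but exchanges left and right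
endpoints. For `i ≥ 1` the orbit of `0` meets no endpoint, so the right copies suffice on both
circles. -/
theorem letterOf_rot_zeroPlus {t : ℝ} (ht : UnitIrrational t) (h : 1 / 2 < t) {i : ℕ}
    (hi : 1 ≤ i) : letterOf t (rot t i zeroPlus) = letterOf (1 - t) (rot (1 - t) i zeroPlus) := by
  set y := Int.fract (0 + i * t) with hy
  have hy₀ : y ≠ 0 := fun h' => by
    rw [hy, Int.fract] at h'
    have := (eq_zero_of_irrational_mul ht.irrational (a := i) (b := 2 * ⌊0 + i * t⌋)
      (by push_cast; linarith)).1
    omega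
  have hy₁ : y ≠ 1 / 2 := fun h' => by
    rw [hy, Int.fract] at h'
    have := (eq_zero_of_irrational_mul ht.irrational (a := i) (b := 2 * ⌊0 + i * t⌋ + 1)
      (by push_cast; linarith)).1
    omega
  have hy₂ : y ≠ 1 - t := fun h' => by
    rw [hy, Int.fract] at h'
    have := (eq_zero_of_irrational_mul ht.irrational (a := i + 1) (b := 2 * ⌊0 + i * t⌋ + 2)
      (by push_cast; linarith)).1
    omega
  have hyI : y ∈ Set.Ico (0 : ℝ) 1 := fract_mem_Ico _
  have hy₀' : 0 < y := lt_of_le_of_ne hyI.1 hy₀.symm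
  have e₁ : rot t i zeroPlus = ⟨y, Side.plus⟩ := rfl
  have e₂ : rot (1 - t) i zeroPlus = ⟨1 - y, Side.plus⟩ := by
    have : (⟨1 - y, Side.plus⟩ : SplitPt) = zeroPlus.shift (1 - y) := by
      simp [zeroPlus, SplitPt.shift]
    rw [this]
    refine rot_eq_of_mem (i - ⌊0 + i * t⌋ - 1) ?_ ?_
    · rw [hy, Int.fract]; push_cast; ring
    · rw [← this]; exact ⟨by dsimp only; linarith [hyI.2], by dsimp only; linarith⟩
  rw [e₂, e₁]
  symm
  have hm' : (⟨1 - y, Side.plus⟩ : SplitPt) ∈ splitIcc 0 1 :=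
    ⟨by dsimp only; linarith [hyI.2], by dsimp only; linarith⟩
  rw [letterOf_eq_iff ht.one_sub hm', ends_one_sub h]
  have hm := (letterOf_eq_iff ht (p := ⟨y, Side.plus⟩) hyI _).1 rfl
  obtain ⟨h₁, h₂⟩ := hm
  dsimp only at h₁ h₂
  set c := letterOf t ⟨y, Side.plus⟩
  have hne : (ends t c).1 ≠ y := by
    obtain ⟨eC, eB, eA⟩ := ends_of_gt h
    rcases c
    · rw [eA]; exact hy₁.symm
    · rw [eB]; exact hy₂.symm
    · rw [eC]; exact hy₀.symm
  have h₃ := lt_of_le_of_ne h₁ hne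
  exact ⟨by dsimp only; linarith, by dsimp only; linarith⟩

theorem length_Psi (w : Word) : (Psi w).length = w.length := by
  cases w <;> rfl

theorem code_zeroPlus_Psi {t : ℝ} (ht : UnitIrrational t) (h : 1 / 2 < t) (n : ℕ) :
    code t zeroPlus n = Psi (code (1 - t) zeroPlus n) := by
  cases n with
  | zero => rfl
  | succ n =>
    rw [code, code, List.range_succ_eq_map, List.map_cons, List.map_cons, List.map_map,
      List.map_map, Psi]
    congr 1
    · rw [rot_zero (zeroPlus_mem_splitIcc one_pos)]
      apply letterOf_C' h
      rw [zeroPlus_ge]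
      linarith [ht.lt_one]
    · exact List.map_congr_left fun i _ => letterOf_rot_zeroPlus ht h (by omega)

theorem code_substZero {t : ℝ} (ht : UnitIrrational t) {w : Word}
    (hw : code (g t) zeroPlus w.length = w) :
    code t zeroPlus (substZero t w).length = substZero t w := by
  by_cases h : pq t 1 = 1
  · have h' := ht.half_lt h
    rw [g_of_eq_one h] at hw
    rw [substZero, if_neg h'.not_gt, length_Psi, code_zeroPlus_Psi ht h', hw]
  · rw [substZero, if_pos (ht.lt_half h)]
    obtain ⟨q, -, hq⟩ := reads_extend_subst ht (p := zeroPlus)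
      (zeroPlus_mem_splitIcc (delta_pos ht)) (w := w) (by rwa [phi_zeroPlus h])
    exact hq.1

theorem Psi_prefix {u v : Word} (h : u <+: v) : Psi u <+: Psi v := by
  obtain ⟨w, rfl⟩ := h
  cases u with
  | nil => exact List.nil_prefix
  | cons c u => exact ⟨w, rfl⟩

theorem substZero_prefix (t : ℝ) {u v : Word} (h : u <+: v) :
    substZero t u <+: substZero t v := by
  unfold substZero
  split_ifs
  · obtain ⟨w, rfl⟩ := h
    rw [extend_append]
    exact List.prefix_append _ _
  · exact Psi_prefix h

theorem baseZero_eq_cons {t : ℝ} (ht : UnitIrrational t) (h : pq t 1 ≠ 1) :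
    ∃ w, baseZero t = Letter.A :: Letter.A :: w := by
  obtain ⟨k, hk⟩ : ∃ k, pq t 1 / 2 = k + 1 := ⟨pq t 1 / 2 - 1, by have := two_le_pq ht h; omega⟩
  simp only [baseZero, hk]
  split_ifs
  · simp only [blk_succ]; exact ⟨_, rfl⟩
  · simp only [List.replicate_succ, List.cons_append]; exact ⟨_, rfl⟩

theorem omegaZero_of_ne_one {t : ℝ} (h : pq t 1 ≠ 1) : omegaZero t = baseZero t := if_neg h

theorem omegaZero_of_eq_one {t : ℝ} (ht : UnitIrrational t) (h : pq t 1 = 1) :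
    omegaZero t = substZero t (omegaZero (g t)) := by
  rw [omegaZero, if_pos h, substZero, if_neg (ht.half_lt h).not_gt,
    omegaZero_of_ne_one (pq_g_ne_one ht h)]

theorem omegaZero_eq_cons_of_eq_one {t : ℝ} (ht : UnitIrrational t) (h : pq t 1 = 1) :
    ∃ w, omegaZero t = Letter.C :: Letter.A :: w := by
  obtain ⟨w, hw⟩ := baseZero_eq_cons ht.g (pq_g_ne_one ht h)
  exact ⟨w, by rw [omegaZero, if_pos h, hw, Psi]⟩

theorem code_zeroPlus_of_ne_one {t : ℝ} (ht : UnitIrrational t) (h : pq t 1 ≠ 1) :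
    code t zeroPlus 1 = [Letter.A] := by
  simp only [code, List.range_one, List.map_cons, List.map_nil,
    rot_zero (zeroPlus_mem_splitIcc one_pos)]
  rw [letterOf_A (ht.lt_half h) (zeroPlus_ge.2 le_rfl) (by rw [zeroPlus_ge]; norm_num)]

theorem code_zeroPlus_of_eq_one {t : ℝ} (ht : UnitIrrational t) (h : pq t 1 = 1) :
    code t zeroPlus 2 = [Letter.C, Letter.A] := by
  have h' := ht.half_lt h
  have h₁ := ht.lt_one
  have hm : zeroPlus.shift t ∈ splitIcc 0 1 := by
    rw [mem_splitIcc, SplitPt.shift_ge, SplitPt.shift_ge, zeroPlus_ge, zeroPlus_ge]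
    constructor <;> linarith
  refine ((reads_singleton (zeroPlus_mem_splitIcc one_pos) (letterOf_C' h' ?_) 0 (by simp)
    hm).append ((reads_code t (zeroPlus.shift t) 1))).1.trans ?_
  · rw [zeroPlus_ge]; linarith
  · simp only [code, List.range_one, List.map_cons, List.map_nil, rot_zero hm]
    rw [letterOf_A' h' _ (mem_splitIcc.1 hm).2]
    · rfl
    · rw [SplitPt.shift_ge, zeroPlus_ge]; linarith

/-- The word `baseZero t` is already determined by the first letters of the next coding. -/
theorem exists_prefix_baseZero {t : ℝ} (ht : UnitIrrational t) (h : pq t 1 ≠ 1) :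
    ∃ v, baseZero t <+: substZero t v ∧ v <+: omegaZero (g t) ∧
      code (g t) zeroPlus v.length = v := by
  simp only [substZero, if_pos (ht.lt_half h)]
  by_cases he : Even (pq t 1)
  · have hpq3 : pq t 3 = pq (g t) 1 := by rw [pq_three, ← g_of_even he]
    by_cases h3 : pq t 3 = 1
    · have h3' := h3
      rw [hpq3] at h3'
      obtain ⟨w, hw⟩ := omegaZero_eq_cons_of_eq_one ht.g h3'
      refine ⟨[Letter.C], ?_, ⟨Letter.A :: w, hw.symm⟩,
        -- When `a₃ = 1` the next coding starts with `C`, and `σ(C)` starts with the required block;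
        -- when `a₃ ≠ 1` it starts with `A`, and `σ(A)` does.
        (Reads.of_append (v := [Letter.C]) (w := [Letter.A])
          (code_zeroPlus_of_eq_one ht.g h3')).1⟩
      simp only [extend_singleton, subst, baseZero, if_neg h, if_pos he, if_pos h3]
      exact List.prefix_append _ _
    · have h3' := h3
      rw [hpq3] at h3'
      obtain ⟨w, hw⟩ := baseZero_eq_cons ht.g h3'
      rw [← omegaZero_of_ne_one h3'] at hw
      refine ⟨[Letter.A], ?_, ⟨Letter.A :: w, hw.symm⟩, code_zeroPlus_of_ne_one ht.g h3'⟩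
      simp only [extend_singleton, subst, baseZero, if_neg h, if_pos he, if_neg h3]
      exact List.prefix_append _ _
  · have hg : pq (g t) 1 = 1 := by
      rw [ht.g.pq_eq_one_iff, g_of_odd h he]
      have := ht.gauss.lt_one
      have := ht.gauss.pos
      rw [div_lt_div_iff₀] <;> linarith
    obtain ⟨w, hw⟩ := omegaZero_eq_cons_of_eq_one ht.g hg
    -- Two letters are needed, as `σ(C)` is only `A`; the image of `CA` is `A^{k+1} B^k C`, one
    -- letter longer than the word sought.
    refine ⟨[Letter.C, Letter.A], ?_, ⟨w, hw.symm⟩, code_zeroPlus_of_eq_one ht.g hg⟩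
    rw [extend_cons, extend_singleton]
    simp only [subst, baseZero, if_neg h, if_neg he]
    exact ⟨[Letter.C], by simp [blk, List.replicate_succ]⟩

theorem omegaZero_prefix {t : ℝ} (ht : UnitIrrational t) :
    omegaZero t <+: substZero t (omegaZero (g t)) := by
  by_cases h : pq t 1 = 1
  · rw [omegaZero_of_eq_one ht h]
  · obtain ⟨v, h₁, h₂, -⟩ := exists_prefix_baseZero ht h
    rw [omegaZero_of_ne_one h]
    exact h₁.trans (substZero_prefix t h₂)

theorem code_omegaZero {t : ℝ} (ht : UnitIrrational t) :
    code t zeroPlus (omegaZero t).length = omegaZero t := by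
  have key : ∀ {t : ℝ}, UnitIrrational t → pq t 1 ≠ 1 →
      code t zeroPlus (omegaZero t).length = omegaZero t := by
    intro t ht h
    obtain ⟨v, h₁, -, h₂⟩ := exists_prefix_baseZero ht h
    rw [omegaZero_of_ne_one h]
    exact code_prefix (code_substZero ht h₂) h₁
  by_cases h : pq t 1 = 1
  · rw [omegaZero_of_eq_one ht h]
    exact code_substZero ht (key ht.g (pq_g_ne_one ht h))
  · exact key ht h

theorem sigmaZeroComp_succ (t : ℝ) (n : ℕ) (w : Word) :
    sigmaZeroComp t (n + 1) w = sigmaZeroComp t n (substZero (thetaSeq t n) w) := rfl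

theorem sigmaZeroComp_prefix (t : ℝ) (n : ℕ) {u v : Word} (h : u <+: v) :
    sigmaZeroComp t n u <+: sigmaZeroComp t n v := by
  induction n generalizing u v with
  | zero => exact h
  | succ n ih => exact ih (substZero_prefix _ h)

theorem code_sigmaZeroComp {t : ℝ} (ht : UnitIrrational t) (n : ℕ) {w : Word}
    (hw : code (thetaSeq t n) zeroPlus w.length = w) :
    code t zeroPlus (sigmaZeroComp t n w).length = sigmaZeroComp t n w := by
  induction n generalizing w with
  | zero => exact hw
  | succ n ih =>
    rw [thetaSeq_succ] at hw
    exact ih (code_substZero (ht.thetaSeq n) hw)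

theorem mem_extend_of_ne_nil {t : ℝ} (ht : UnitIrrational t) (h : pq t 1 ≠ 1) {w : Word}
    (hw : w ≠ []) : Letter.A ∈ extend (subst t) w := by
  obtain ⟨c, w, rfl⟩ := List.exists_cons_of_ne_nil hw
  obtain ⟨v, hv⟩ := subst_eq_cons ht h c
  rw [extend_cons, hv]
  simp

/-- The tail matters because `Ψ` may overwrite the first letter. A surviving `A` forces growth at
every level with `a₁ ≠ 1`, since its image has at least two letters. -/
theorem mem_tail_substZero {t : ℝ} (ht : UnitIrrational t) {w : Word}
    (hw : Letter.A ∈ w.tail) : Letter.A ∈ (substZero t w).tail := by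
  cases w with
  | nil => simp at hw
  | cons c w =>
    unfold substZero
    split_ifs with h
    · have h' : pq t 1 ≠ 1 := fun h' => (ht.half_lt h').not_gt h
      obtain ⟨v, hv⟩ := subst_eq_cons ht h' c
      rw [extend_cons, hv, List.cons_append, List.tail_cons]
      exact List.mem_append_right _ (mem_extend_of_ne_nil ht h' (List.ne_nil_of_mem hw))
    · exact hw

theorem length_lt_length_extend {t : ℝ} (ht : UnitIrrational t) (h : pq t 1 ≠ 1) {w : Word}
    (hw : Letter.A ∈ w) : w.length + 1 ≤ (extend (subst t) w).length := by
  obtain ⟨u, v, rfl⟩ := List.append_of_mem hw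
  obtain ⟨r, hr, e⟩ := subst_A_eq_cons ht h
  have h₁ := length_le_length_extend (subst_ne_nil ht) u
  have h₂ := length_le_length_extend (subst_ne_nil ht) v
  have h₃ := List.length_pos_iff.2 hr
  simp only [extend_append, extend_cons, e, List.length_append, List.length_cons]
  omega

theorem length_add_count_le {t : ℝ} (ht : UnitIrrational t) (n : ℕ) {w : Word}
    (hw : Letter.A ∈ w.tail) :
    w.length + Nat.count (fun m => pq (thetaSeq t m) 1 ≠ 1) n ≤
      (sigmaZeroComp t n w).length := by
  induction n generalizing w with
  | zero => simp [sigmaZeroComp, compSeq]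
  | succ n ih =>
    have h₁ := ih (mem_tail_substZero (ht.thetaSeq n) hw)
    rw [sigmaZeroComp_succ, Nat.count_succ]
    by_cases h : pq (thetaSeq t n) 1 = 1
    · have : (substZero (thetaSeq t n) w).length = w.length := by
        rw [substZero, if_neg ((ht.thetaSeq n).half_lt h).not_gt, length_Psi]
      rw [if_neg (not_not.2 h)]
      omega
    · have := length_lt_length_extend (ht.thetaSeq n) h (List.mem_of_mem_tail hw)
      rw [← show substZero (thetaSeq t n) w = extend (subst (thetaSeq t n)) w from
        if_pos ((ht.thetaSeq n).lt_half h)] at this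
      rw [if_pos h]
      omega

theorem mem_tail_omegaZero {t : ℝ} (ht : UnitIrrational t) :
    Letter.A ∈ (omegaZero t).tail := by
  by_cases h : pq t 1 = 1
  · obtain ⟨w, hw⟩ := omegaZero_eq_cons_of_eq_one ht h
    simp [hw]
  · obtain ⟨w, hw⟩ := baseZero_eq_cons ht h
    rw [omegaZero_of_ne_one h]
    simp [hw]

theorem exists_le_count {t : ℝ} (ht : UnitIrrational t) (N : ℕ) :
    ∃ n, N ≤ Nat.count (fun m => pq (thetaSeq t m) 1 ≠ 1) n := by
  induction N with
  | zero => exact ⟨0, Nat.zero_le _⟩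
  | succ N ih =>
    obtain ⟨n, hn⟩ := ih
    obtain ⟨m, hm, h⟩ := Filter.frequently_atTop.1 (frequently_pq_ne_one ht) n
    refine ⟨m + 1, ?_⟩
    rw [Nat.count_succ, if_pos h]
    have := Nat.count_monotone (fun m => pq (thetaSeq t m) 1 ≠ 1) hm
    omega

theorem isChainLimit_zero {t : ℝ} (ht : UnitIrrational t) :
    IsChainLimit (fun n => sigmaZeroComp t n (omegaZero (thetaSeq t n)))
      (fun i => letterOf t (rot t i zeroPlus)) := by
  refine isChainLimit_of_code (fun n => ?_)
    (fun n => code_sigmaZeroComp ht n (code_omegaZero (ht.thetaSeq n))) fun N => ?_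
  · rw [sigmaZeroComp_succ, thetaSeq_succ]
    exact sigmaZeroComp_prefix t n (omegaZero_prefix (ht.thetaSeq n))
  · obtain ⟨n, hn⟩ := exists_le_count ht N
    have := length_add_count_le ht n (mem_tail_omegaZero (ht.thetaSeq n))
    exact ⟨n, by omega⟩

end HalfDiscrepancy

theorem theorem1 (θ : ℝ) (hθ : Irrational θ) :
    -- infinitely many of the substitutions are not the identity
    (∃ᶠ n in Filter.atTop, HalfDiscrepancy.subst (HalfDiscrepancy.thetaSeq (Int.fract θ) n) ≠
      fun c => [c]) ∧
    -- the orbit of an arbitrary point, for each choice of stopping times in the process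
    (∀ x ∈ Set.Ico (0 : ℝ) 1, ∀ p : HalfDiscrepancy.SplitPt, HalfDiscrepancy.IsLift x p →
      (∃ τ : ℕ → ℕ, HalfDiscrepancy.Admissible (Int.fract θ) p τ ∧
        ∃ᶠ n in Filter.atTop, HalfDiscrepancy.omegaWord (Int.fract θ) p τ n ≠ []) ∧
      ∀ τ : ℕ → ℕ, HalfDiscrepancy.Admissible (Int.fract θ) p τ →
        ∃ W : ℕ → HalfDiscrepancy.Letter,
          (∀ u : ℕ → HalfDiscrepancy.Word, (∀ n, u n ≠ []) →
            HalfDiscrepancy.ConvergesTo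
              (fun n => HalfDiscrepancy.nested (HalfDiscrepancy.omegaWord (Int.fract θ) p τ)
                (fun m => HalfDiscrepancy.subst (HalfDiscrepancy.thetaSeq (Int.fract θ) m))
                n (u n)) W) ∧
          ((∃ᶠ n in Filter.atTop, HalfDiscrepancy.omegaWord (Int.fract θ) p τ n ≠ []) →
            HalfDiscrepancy.IsChainLimit
              (fun n => HalfDiscrepancy.nested (HalfDiscrepancy.omegaWord (Int.fract θ) p τ)
                (fun m => HalfDiscrepancy.subst (HalfDiscrepancy.thetaSeq (Int.fract θ) m))
                n []) W) ∧
          HalfDiscrepancy.EncodesUpToEndpoints θ x W) ∧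
    -- the unique point `x(θ)` for which all the words of the process may be taken empty
    (∃ x₀ ∈ Set.Ico (0 : ℝ) 1,
      (∀ y ∈ Set.Ico (0 : ℝ) 1,
        (∃ p : HalfDiscrepancy.SplitPt, HalfDiscrepancy.IsLift y p ∧
          HalfDiscrepancy.Admissible (Int.fract θ) p (fun _ => 0)) ↔ y = x₀) ∧
      ∃ W : ℕ → HalfDiscrepancy.Letter,
        (∀ w : HalfDiscrepancy.Word, w ≠ [] →
          HalfDiscrepancy.ConvergesTo
            (fun n => HalfDiscrepancy.sigmaComp (Int.fract θ) n w) W) ∧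
        HalfDiscrepancy.EncodesUpToEndpoints θ x₀ W) ∧
    -- the orbit of zero
    (∃ W : ℕ → HalfDiscrepancy.Letter,
      HalfDiscrepancy.IsChainLimit
        (fun n => HalfDiscrepancy.sigmaZeroComp (Int.fract θ) n
          (HalfDiscrepancy.omegaZero (HalfDiscrepancy.thetaSeq (Int.fract θ) n))) W ∧
      HalfDiscrepancy.Encodes (HalfDiscrepancy.arc (Int.fract θ)) θ 0 W) := by
  have ht := HalfDiscrepancy.unitIrrational_fract hθ
  refine ⟨HalfDiscrepancy.frequently_subst_ne_id ht, ?_, ?_, ?_⟩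
  · intro x hx p hp
    refine ⟨HalfDiscrepancy.exists_admissible ht p, fun τ hτ => ⟨_,
      fun u hu => HalfDiscrepancy.convergesTo_nested ht hτ hu,
      fun hω => HalfDiscrepancy.isChainLimit_nested ht hτ hω, ?_⟩⟩
    rw [HalfDiscrepancy.isLift_iff.1 hp]
    exact HalfDiscrepancy.encodesUpToEndpoints_of_lift hθ _
  · obtain ⟨p, hp, hτ⟩ := HalfDiscrepancy.exists_admissible_zero ht
    obtain ⟨x₀, hx₀, hlift⟩ := HalfDiscrepancy.exists_isLift hp
    refine ⟨x₀, hx₀, fun y hy => ⟨?_, ?_⟩, _, fun w hw =>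
      HalfDiscrepancy.convergesTo_nested ht hτ (u := fun _ => w) fun _ => hw, ?_⟩
    · rintro ⟨q, hq, hτ'⟩
      exact hq.eq_of_pos_eq hy hx₀ hlift
        (HalfDiscrepancy.admissible_zero_pos_unique ht (hq.mem hy) hp hτ' hτ)
    · rintro rfl
      exact ⟨p, hlift, hτ⟩
    · rw [HalfDiscrepancy.isLift_iff.1 hlift]
      exact HalfDiscrepancy.encodesUpToEndpoints_of_lift hθ _
  · refine ⟨_, HalfDiscrepancy.isChainLimit_zero ht, ?_⟩
    -- The coding is that of the right copy `0⁺`, and right copies see exactly the half-open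
    -- partition, so no errors occur.
    rw [← HalfDiscrepancy.sidePart_plus ht]
    exact HalfDiscrepancy.encodes_sidePart HalfDiscrepancy.Side.plus
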